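/- Let $\mathcal G$ be a finite graph (loops and multiple edges allowed) embedded on an annulus $\Sigma$ so that every complementary component is either contractible (a face) or an annular neighbourhood of a boundary component of $\Sigma$, with exactly one component of the latter kind for each of the two boundary components (in particular $\mathcal G$ is connected and contains a cycle winding around $\Sigma$). Let $c_e>0$ be conductances on the edges $e$ (for instance $c\equiv 1$). A connection on a complex line bundle over $\mathcal G$ is a choice, for each oriented edge from $v$ to $v'$, of a parallel transport $\phi_{vv'}\in\mathbb C^*$, with the inverse number for the reversed edge; it is flat with monodromy $z\in\mathbb C^*$ if the product of the parallel transports is $1$ around every face and $z$ along the peripheral cycle of $\mathcal G$ that bounds the complementary component at the inner boundary of $\Sigma$ (so $z$ is the monodromy around the annulus). Its Laplacian acts on functions $f$ from the vertices to $\mathbb C$ by $$\Delta f(v)=\sum_{e=vv'}c_{e}\bigl(f(v)-\phi_{v'v}f(v')\bigr),$$ the sum being over the oriented edges $e$ that start at $v$. For every $z\in\mathbb C^*$ there is a flat connection with monodromy $z$, and there is a Laurent polynomial $P\in\mathbb C[z,z^{-1}]$ such that $\det\Delta=P(z)$ for every $z\in\mathbb C^*$ and every flat connection with monodromy $z$.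 It is reciprocal, $P(z)=P(1/z)$; all its complex roots are real and positive; and $z=1$ is a root of multiplicity exactly two. -/

import Mathlib

open scoped LaurentPolynomial

noncomputable section

/-- A finite graph (loops and multiple edges allowed) with vertex set `V`, drawn on an oriented
surface, given by its rotation system. `D` is the set of darts (oriented edges), `tail d` is the
vertex from which `d` starts, `rev` reverses a dart, and `rot` sends a dart to the next dart,
in the cyclic order given by the orientation of the surface, that starts at the same vertex. -/
structure EmbeddedGraph (V D : Type*) where
  tail : D → V
  rev : Equiv.Perm D
  rot : Equiv.Perm D
  rev_rev : ∀ d, rev (rev d) = d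
  rev_ne : ∀ d, rev d ≠ d
  tail_eq_iff : ∀ d d', tail d = tail d' ↔ rot.SameCycle d d'

namespace EmbeddedGraph

variable {V D : Type*} (G : EmbeddedGraph V D)

/-- The endpoint of a dart. -/
def head (d : D) : V := G.tail (G.rev d)

/-- The graph is connected: any two vertices are joined by a walk. -/
def Connected : Prop :=
  ∀ v w : V, Relation.ReflTransGen (fun a b => ∃ d, G.tail d = a ∧ G.head d = b) v w

/-- Unoriented edges: darts up to reversal. -/
def Edge : Type _ := Quotient (Equiv.Perm.SameCycle.setoid G.rev)

/-- The dart that follows `d` on the boundary walk of the face that lies along `d`: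
go along `d` to its head and leave by the next dart there. -/
def facePerm : Equiv.Perm D := G.rev.trans G.rot

/-- Faces (complementary components): the orbits of `facePerm`, that is, the closed walks
that bound the complementary components. -/
def Face : Type _ := Quotient (Equiv.Perm.SameCycle.setoid G.facePerm)

/-- The face that lies along a dart. -/
def faceOf (d : D) : G.Face := Quotient.mk (Equiv.Perm.SameCycle.setoid G.facePerm) d

end EmbeddedGraph

/-- A surface graph on an annulus: a connected graph `G` with two different faces `inner` and
`outer`. Gluing an annulus (a collar of a boundary component) along the boundary walk of each of
these two faces, and a disk along the boundary walk of every other face, gives a connected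
oriented compact surface with two boundary components; it is an annulus exactly if capping off
the two boundary components gives a sphere, that is, if `|V| - |E| + |F| = 2`, where `F` is the
set of all faces, including `inner` and `outer`. -/
structure AnnularGraph (V D : Type*) extends EmbeddedGraph V D where
  connected : toEmbeddedGraph.Connected
  inner : toEmbeddedGraph.Face
  outer : toEmbeddedGraph.Face
  inner_ne_outer : inner ≠ outer
  euler : (Nat.card V : ℤ) - Nat.card toEmbeddedGraph.Edge + Nat.card toEmbeddedGraph.Face = 2

namespace EmbeddedGraph

variable {V D : Type*} (G : EmbeddedGraph V D)

/-- A connection on a complex line bundle over `G`, the fibre over each vertex being identified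
with `ℂ`: the parallel transport along the dart `d`, from the fibre over `tail d` to the fibre
over `head d`, is multiplication by `transport d`. -/
structure Connection where
  transport : D → ℂˣ
  transport_rev : ∀ d, transport (G.rev d) = (transport d)⁻¹

/-- A system of conductances: positive weights on the unoriented edges. -/
structure Conductance where
  weight : D → ℝ
  weight_pos : ∀ d, 0 < weight d
  weight_rev : ∀ d, weight (G.rev d) = weight d

variable {G}

open Classical in
/-- The monodromy of a connection around a face: the product of the parallel transports along
the darts of its boundary walk (each dart of the orbit occurs once on that walk). -/
def Connection.monodromy [Fintype D] (Φ : G.Connection) (F : G.Face) : ℂˣ :=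
  ∏ d with G.faceOf d = F, Φ.transport d

open Classical in
/-- The Laplacian of a line bundle with connection and conductances, on sections:
`Δ f (v) = ∑ c_{vv'} (f v - φ_{v'v} f v')`, the sum being over the darts from `v` to some
vertex `v'`, and `φ_{v'v}` being the parallel transport along the reversed dart. -/
def laplacian [Fintype D] (c : G.Conductance) (Φ : G.Connection) : (V → ℂ) →ₗ[ℂ] (V → ℂ) where
  toFun f v := ∑ d with G.tail d = v,
    (c.weight d : ℂ) * (f v - (Φ.transport (G.rev d) : ℂ) * f (G.head d))
  map_add' f g := by
    funext v
    simp only [Pi.add_apply, ← Finset.sum_add_distrib]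
    exact Finset.sum_congr rfl fun d _ => by ring
  map_smul' a f := by
    funext v
    simp only [Pi.smul_apply, smul_eq_mul, RingHom.id_apply, Finset.mul_sum]
    exact Finset.sum_congr rfl fun d _ => by ring

end EmbeddedGraph

/-- The connection `Φ` on an annular graph is flat, with monodromy `z`: its monodromy is trivial
around every face other than the two peripheral ones, and it is `z` around the annulus, that is,
along the peripheral cycle that bounds the inner complementary component. -/
def AnnularGraph.IsFlatWithMonodromy {V D : Type*} [Fintype D] (G : AnnularGraph V D)
    (Φ : G.toEmbeddedGraph.Connection) (z : ℂˣ) : Prop :=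
  (∀ F : G.toEmbeddedGraph.Face, F ≠ G.inner → F ≠ G.outer → Φ.monodromy F = 1) ∧
    Φ.monodromy G.inner = z

/-- The value `P(z)` of a complex Laurent polynomial at a nonzero complex number. -/
def laurentEval (z : ℂˣ) (P : ℂ[T;T⁻¹]) : ℂ := LaurentPolynomial.eval₂ (RingHom.id ℂ) z P

end

/-! On a genus-zero map an integral 1-cochain `n` has coboundary "inner minus outer"
(`exists_cochain`), so the transports `z ^ n d` form a flat connection of monodromy `z`. Planarity
kills the first cohomology (`exists_gauge`), so any other flat connection of monodromy `z` is gauge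
equivalent to it and has the same determinant. Hence `P` is the determinant of one matrix over the
Laurent polynomials. Inverting the variable transposes this matrix, which gives reciprocity.

Positivity of the roots is a discrete Gauss-Bonnet argument. Let `f` be in the kernel and `ω` its
covariant derivative. Around a vertex, the values of `ω` with the conductances as coefficients sum
to zero, so read in cyclic order they turn by at least `2π` (`two_pi_le_sum_abs_arg`). Around a face
of trivial monodromy the values of `ω`, transported to one fibre, also sum to zero and turn by at
least `2π`; around a face of monodromy `z` or its inverse they turn by at least `θ = |arg z|`. At
each corner the vertex turning and the face turning add up to `π`. When `ω` has no zeros, the sum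
over all corners gives `2πE ≥ 2πV + 2πF - 2(2π - θ)`, and `V - E + F = 2` forces `θ = 0`.

Edges on which `ω` vanishes have to be cut away first. Each dart is detached from its vertex, which
keeps the genus zero (`eulerDefect_detach`) but may merge faces and disconnect the map. What
survives is `OscillationBound`: on each component the exponents of the face monodromies have
absolute value at most one, and their absolute values sum to at most two. The count then runs
component by component (`form_eq_zero_of_arg_ne_zero`). So `arg z ≠ 0` makes `f` parallel, hence
zero.

At `z = 1` the constants lie in the kernel, and reciprocity makes the root at least double. On the
unit circle the Dirichlet energy of a column of the adjugate bounds `|z - 1|²` times a principal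
minor by a constant times `|P(z)|` (`AnnularGraph.norm_minor_le`). The minor does not vanish at `1`,
so the multiplicity is exactly two. -/

open scoped LaurentPolynomial

/-! ### Functions constant on the cycles of permutations: counting vertices, edges, faces and
components as dimensions. -/

section ClassFunctions

variable {D : Type*}

/-- The real functions that are constant on the classes of a setoid. -/
def classFun (r : Setoid D) : Submodule ℝ (D → ℝ) where
  carrier := {x | r ≤ Setoid.ker x}
  add_mem' {x y} hx hy a b h := by
    have h1 : x a = x b := hx h
    have h2 : y a = y b := hy h
    simp [h1, h2]
  zero_mem' a b _ := rfl
  smul_mem' c x hx a b h := by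
    have h1 : x a = x b := hx h
    simp [h1]

theorem mem_classFun {r : Setoid D} {x : D → ℝ} :
    x ∈ classFun r ↔ ∀ a b, r a b → x a = x b :=
  ⟨fun h _ _ hab => h hab, fun h _ _ hab => h _ _ hab⟩

theorem classFun_sup (r s : Setoid D) : classFun (r ⊔ s) = classFun r ⊓ classFun s := by
  ext x
  exact sup_le_iff (a := r) (b := s) (c := Setoid.ker x)

/-- The indicator of the class of `b` is a class function, so class functions separate classes.
Questions about orbits can thus be settled by linear algebra. -/
theorem rel_of_forall_classFun {r : Setoid D} {a b : D}
    (h : ∀ x ∈ classFun r, x a = x b) : r a b := by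
  classical
  have := h (fun d => if r d b then 1 else 0) (mem_classFun.2 fun c d hcd => by
    have : r c b ↔ r d b := ⟨fun h => r.trans (r.symm hcd) h, fun h => r.trans hcd h⟩
    simp [this])
  by_contra hab
  simp [hab] at this

theorem finrank_classFun [Finite D] (r : Setoid D) :
    Module.finrank ℝ (classFun r) = Nat.card (Quotient r) := by
  have := Fintype.ofFinite (Quotient r)
  let e : (Quotient r → ℝ) ≃ₗ[ℝ] classFun r :=
    { toFun := fun g => ⟨fun d => g (Quotient.mk r d), mem_classFun.2 fun a b h => by
        rw [Quotient.sound h]⟩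
      map_add' := fun _ _ => rfl
      map_smul' := fun _ _ => rfl
      invFun := fun x => Quotient.lift x.1 (mem_classFun.1 x.2)
      left_inv := fun g => by
        ext q
        induction q using Quotient.inductionOn
        rfl
      right_inv := fun x => rfl }
  rw [← e.finrank_eq, Module.finrank_pi, Nat.card_eq_fintype_card]

/-- The setoid whose classes are the cycles of a permutation, fixed points included. -/
abbrev cyc (σ : Equiv.Perm D) : Setoid D := Equiv.Perm.SameCycle.setoid σ

theorem cyc_le_iff {σ : Equiv.Perm D} {r : Setoid D} : cyc σ ≤ r ↔ ∀ d, r (σ d) d := by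
  refine ⟨fun h d => r.symm (h ⟨1, by simp⟩), ?_⟩
  rintro h a _ ⟨i, rfl⟩
  have h' : ∀ d, r (σ⁻¹ d) d := fun d => r.symm (by simpa using h (σ⁻¹ d))
  induction i using Int.induction_on with
  | zero => exact r.refl _
  | succ n ih =>
    rw [add_comm, zpow_add, zpow_one, Equiv.Perm.mul_apply]
    exact r.trans ih (r.symm (h _))
  | pred n ih =>
    rw [sub_eq_add_neg, add_comm, zpow_add, zpow_neg_one, Equiv.Perm.mul_apply]
    exact r.trans ih (r.symm (h' _))

theorem mem_classFun_cyc {σ : Equiv.Perm D} {x : D → ℝ} :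
    x ∈ classFun (cyc σ) ↔ ∀ d, x (σ d) = x d :=
  cyc_le_iff (r := Setoid.ker x)

/-- The setoid whose classes are the orbits of the group generated by two permutations. -/
abbrev orbits (σ α : Equiv.Perm D) : Setoid D := cyc σ ⊔ cyc α

theorem mem_classFun_orbits {σ α : Equiv.Perm D} {x : D → ℝ} :
    x ∈ classFun (orbits σ α) ↔ (∀ d, x (σ d) = x d) ∧ ∀ d, x (α d) = x d := by
  rw [classFun_sup, Submodule.mem_inf, mem_classFun_cyc, mem_classFun_cyc]

theorem cyc_apply (σ : Equiv.Perm D) (d : D) : cyc σ (σ d) d :=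
  Setoid.symm' _ ⟨1, by simp⟩

theorem orbits_right (σ α : Equiv.Perm D) (d : D) : orbits σ α (α d) d :=
  (le_sup_right : cyc α ≤ orbits σ α) (cyc_apply α d)

theorem cyc_mul_le_orbits (σ α : Equiv.Perm D) : cyc (σ * α) ≤ orbits σ α := by
  intro a b h
  refine rel_of_forall_classFun fun x hx => ?_
  rw [mem_classFun_orbits] at hx
  have : x ∈ classFun (cyc (σ * α)) := mem_classFun_cyc.2 fun d => by
    rw [Equiv.Perm.mul_apply, hx.1, hx.2]
  exact mem_classFun.1 this a b h

end ClassFunctions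

/-! ### Genus of a combinatorial map and its behaviour when a dart is detached. -/

section Defect

theorem finrank_inf_ker_of_not_le {E : Type*} [AddCommGroup E] [Module ℝ E]
    [FiniteDimensional ℝ E] {U : Submodule ℝ E} {f : E →ₗ[ℝ] ℝ} (h : ¬ U ≤ LinearMap.ker f) :
    Module.finrank ℝ (U ⊓ LinearMap.ker f : Submodule ℝ E) + 1 = Module.finrank ℝ U := by
  have h1 := LinearMap.finrank_range_add_finrank_ker (f.domRestrict U)
  have h2 : LinearMap.range (f.domRestrict U) = ⊤ := by
    refine LinearMap.range_eq_top.2 (LinearMap.surjective_of_ne_zero fun h0 => h fun x hx => ?_)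
    exact LinearMap.congr_fun h0 ⟨x, hx⟩
  have h3 : Module.finrank ℝ (LinearMap.ker (f.domRestrict U)) =
      Module.finrank ℝ (U ⊓ LinearMap.ker f : Submodule ℝ E) := by
    rw [LinearMap.ker_domRestrict, ← Submodule.map_comap_subtype,
      Submodule.finrank_map_subtype_eq]
  rw [h2, finrank_top, Module.finrank_self, h3] at h1
  omega

theorem finrank_le_finrank_inf_ker_add_one {E : Type*} [AddCommGroup E] [Module ℝ E]
    [FiniteDimensional ℝ E] (U : Submodule ℝ E) (f : E →ₗ[ℝ] ℝ) :
    Module.finrank ℝ U ≤ Module.finrank ℝ (U ⊓ LinearMap.ker f : Submodule ℝ E) + 1 := by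
  by_cases h : U ≤ LinearMap.ker f
  · rw [inf_eq_left.2 h]; omega
  · exact (finrank_inf_ker_of_not_le h).ge

variable {D : Type*}

/-- Twice the number of orbits minus the Euler characteristic `V - E + F` of the map
with rotation `σ` and dart reversal `α`, that is, twice the total genus. -/
noncomputable def eulerDefect (σ α : Equiv.Perm D) : ℤ :=
  2 * Module.finrank ℝ (classFun (orbits σ α)) - Module.finrank ℝ (classFun (cyc σ))
    + Module.finrank ℝ (classFun (cyc α)) - Module.finrank ℝ (classFun (cyc (σ * α)))

open Classical in
/-- The rotation `σ` with the dart `a` taken out of its cycle. -/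
noncomputable def detach (σ : Equiv.Perm D) (a : D) : Equiv.Perm D := Equiv.swap a (σ a) * σ

theorem detach_self (σ : Equiv.Perm D) (a : D) : detach σ a a = a := by
  simp [detach]

theorem detach_of_fixed {σ : Equiv.Perm D} {a d : D} (h : σ d = d) : detach σ a d = d := by
  classical
  rw [detach, Equiv.Perm.mul_apply, h]
  by_cases hda : d = a
  · subst hda; rw [h]; simp
  · refine Equiv.swap_apply_of_ne_of_ne hda fun hd => hda ?_
    exact σ.injective (h.trans hd)

theorem detach_eq_self {σ : Equiv.Perm D} {a : D} (h : σ a = a) : detach σ a = σ := by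
  classical
  rw [detach, h, Equiv.swap_self]
  rfl

theorem apply_detach {β : Type*} {σ : Equiv.Perm D} {a : D} {x : D → β}
    (h : x a = x (σ a)) (d : D) : x (detach σ a d) = x (σ d) := by
  classical
  rw [detach, Equiv.Perm.mul_apply, Equiv.swap_apply_def]
  split_ifs with h1 h2
  · rw [h1, h]
  · rw [h2, h]
  · rfl

theorem apply_detach_mul {β : Type*} {σ α : Equiv.Perm D} {a : D} {x : D → β} (h : x a = x (σ a))
    (d : D) : x ((detach σ a * α) d) = x ((σ * α) d) := by
  simpa using apply_detach h (α d)

/-- If `a` and `b` lie on different cycles of `ψ`, then they lie on the same cycle of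
`swap a b * ψ`. -/
theorem eq_of_not_sameCycle [Fintype D] {φ ψ : Equiv.Perm D} {a b : D}
    (h : ¬ cyc ψ a b) (hne : ∀ d, ψ d ≠ a → ψ d ≠ b → φ d = ψ d)
    (ha : ∀ d, ψ d = a → φ d = b) {y : D → ℝ} (hy : y ∈ classFun (cyc φ)) : y a = y b := by
  classical
  rw [mem_classFun_cyc] at hy
  let C : Finset D := Finset.univ.filter fun d => cyc ψ d a
  have hC : ∀ d, ψ d ∈ C ↔ d ∈ C := fun d => by
    simp only [C, Finset.mem_filter, Finset.mem_univ, true_and]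
    exact ⟨fun h => Setoid.trans' _ (Setoid.symm' _ (cyc_apply ψ d)) h,
      fun h => Setoid.trans' _ (cyc_apply ψ d) h⟩
  have hsum : ∑ d ∈ C, y (ψ d) = ∑ d ∈ C, y d :=
    Finset.sum_bij (fun d _ => ψ d) (fun d hd => (hC d).2 hd) (fun _ _ _ _ h => ψ.injective h)
      (fun d hd => ⟨ψ⁻¹ d, (hC _).1 (by simpa using hd), by simp⟩) (fun _ _ => rfl)
  -- Both `y ∘ ψ` and `y ∘ φ` have the same sum over the `ψ`-cycle of `a`. They differ there only at
  -- `ψ⁻¹ a`, because `b` is not on this cycle; that single term is `y a - y b`.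
  have hsum' : ∑ d ∈ C, (y (ψ d) - y (φ d)) = 0 := by
    rw [Finset.sum_sub_distrib, hsum, sub_eq_zero]
    exact Finset.sum_congr rfl fun d _ => (hy d).symm
  rw [Finset.sum_eq_single_of_mem (ψ⁻¹ a)
    ((hC _).1 (by simp [C]))] at hsum'
  · rw [ha _ (by simp)] at hsum'
    rw [show ψ (ψ⁻¹ a) = a by simp] at hsum'
    linarith
  · intro d hd hda
    rw [hne d (fun h => hda (by rw [← h]; simp)) (fun hb => h ?_), sub_self]
    have := (hC d).2 hd
    simp only [C, Finset.mem_filter, Finset.mem_univ, true_and, hb] at this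
    exact Setoid.symm' _ this

/-- The linear form `x ↦ x a - x b`. -/
def evalSub (a b : D) : (D → ℝ) →ₗ[ℝ] ℝ where
  toFun x := x a - x b
  map_add' x y := by simp only [Pi.add_apply]; ring
  map_smul' c x := by simp only [Pi.smul_apply, smul_eq_mul, RingHom.id_apply]; ring

theorem mem_ker_evalSub {a b : D} {x : D → ℝ} : x ∈ LinearMap.ker (evalSub a b) ↔ x a = x b := by
  simp [evalSub, sub_eq_zero]

theorem classFun_cyc_detach_inf_ker {σ α : Equiv.Perm D} {a : D} :
    classFun (cyc (detach σ a * α)) ⊓ LinearMap.ker (evalSub a (σ a)) =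
      classFun (cyc (σ * α)) ⊓ LinearMap.ker (evalSub a (σ a)) := by
  ext x
  simp only [Submodule.mem_inf, mem_classFun_cyc, mem_ker_evalSub]
  refine and_congr_left fun h => forall_congr' fun d => ?_
  rw [apply_detach_mul h]

theorem classFun_orbits_detach_inf_ker {σ α : Equiv.Perm D} {a : D} :
    classFun (orbits (detach σ a) α) ⊓ LinearMap.ker (evalSub a (σ a)) =
      classFun (orbits σ α) := by
  ext x
  simp only [Submodule.mem_inf, mem_classFun_orbits, mem_ker_evalSub]
  refine ⟨fun ⟨⟨h1, h2⟩, h3⟩ => ⟨fun d => ?_, h2⟩, fun ⟨h1, h2⟩ => ⟨⟨fun d => ?_, h2⟩, (h1 a).symm⟩⟩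
  · rw [← apply_detach h3, h1]
  · rw [apply_detach (h1 a).symm, h1]

theorem cyc_involution_iff {α : Equiv.Perm D} (hα : ∀ d, α (α d) = d) (d e : D) :
    cyc α e d ↔ e = d ∨ e = α d := by
  constructor
  · intro h
    have hs : cyc α d e := Setoid.symm' _ h
    obtain ⟨i, rfl⟩ := hs
    have h2 : α ^ (2 : ℤ) = 1 := by ext d; rw [zpow_two, Equiv.Perm.mul_apply, hα]; rfl
    rcases Int.even_or_odd' i with ⟨k, rfl | rfl⟩
    · left; simp [zpow_mul, h2]
    · right; simp [zpow_add, zpow_mul, h2]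
  · rintro (rfl | rfl)
    · exact Setoid.refl' _ _
    · exact cyc_apply α d

variable [Fintype D]

theorem finrank_classFun_cyc_detach {σ : Equiv.Perm D} {a : D} (ha : σ a ≠ a) :
    Module.finrank ℝ (classFun (cyc (detach σ a))) =
      Module.finrank ℝ (classFun (cyc σ)) + 1 := by
  classical
  have h1 : classFun (cyc (detach σ a)) ⊓ LinearMap.ker (evalSub a (σ a)) = classFun (cyc σ) := by
    ext x
    simp only [Submodule.mem_inf, mem_classFun_cyc, mem_ker_evalSub]
    refine ⟨fun ⟨h1, h3⟩ d => ?_, fun h1 => ⟨fun d => ?_, (h1 a).symm⟩⟩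
    · rw [← apply_detach h3, h1]
    · rw [apply_detach (h1 a).symm, h1]
  rw [← h1]
  refine (finrank_inf_ker_of_not_le fun hle => ?_).symm
  have := hle (x := Pi.single a 1) (mem_classFun_cyc.2 fun d => ?_)
  · rw [mem_ker_evalSub] at this
    simp [ha] at this
  · by_cases hd : d = a
    · rw [hd, detach_self]
    · have : detach σ a d ≠ a := fun h =>
        hd ((detach σ a).injective (h.trans (detach_self σ a).symm))
      simp [hd, this]

/-- Detaching a dart does not increase the genus. If the genus stays the same, then the two
sides of the cut corner lie on one face unless they lie in different components. -/
theorem eulerDefect_detach (σ α : Equiv.Perm D) (a : D) :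
    eulerDefect (detach σ a) α ≤ eulerDefect σ α ∧
    (eulerDefect σ α ≤ eulerDefect (detach σ a) α → orbits (detach σ a) α a (σ a) →
      ∀ y ∈ classFun (cyc (detach σ a * α)), y a = y (σ a)) := by
  classical
  by_cases ha : σ a = a
  · rw [detach_eq_self ha, ha]
    exact ⟨le_rfl, fun _ _ _ _ => rfl⟩
  have hV := finrank_classFun_cyc_detach ha
  have hC := classFun_orbits_detach_inf_ker (σ := σ) (α := α) (a := a)
  have hF := classFun_cyc_detach_inf_ker (σ := σ) (α := α) (a := a)
  set f := evalSub a (σ a)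
  have hfx : ∀ x, x ∈ LinearMap.ker f ↔ x a = x (σ a) := fun x => mem_ker_evalSub
  -- If `a` and `σ a` stay connected, there is one more vertex and no new component. The face counts
  -- differ by at most one, and equal defects mean that a face was lost, which forces `a` and `σ a`
  -- onto one face of the detached map.
  by_cases hab : orbits (detach σ a) α a (σ a)
  · have hle : classFun (orbits (detach σ a) α) ≤ LinearMap.ker f := fun x hx =>
      (hfx x).2 (mem_classFun.1 hx _ _ hab)
    rw [inf_eq_left.2 hle] at hC
    have h1 := finrank_le_finrank_inf_ker_add_one (classFun (cyc (σ * α))) f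
    have h2 := Submodule.finrank_mono
      (inf_le_left : classFun (cyc (detach σ a * α)) ⊓ LinearMap.ker f ≤ _)
    rw [hF] at h2
    have hC' := congrArg (fun U : Submodule ℝ (D → ℝ) => Module.finrank ℝ U) hC
    simp only [eulerDefect] at hC' ⊢
    refine ⟨by omega, fun h _ y hy => ?_⟩
    by_contra hne
    have := finrank_inf_ker_of_not_le (U := classFun (cyc (detach σ a * α))) (f := f)
      fun hle => hne ((hfx y).1 (hle hy))
    rw [hF] at this
    omega
  -- If the component splits, the numbers of components, vertices and faces all go up by one, and
  -- the defect `2C - V + E - F` does not change.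
  · refine ⟨?_, fun _ h => absurd h hab⟩
    have hC1 := finrank_inf_ker_of_not_le (U := classFun (orbits (detach σ a) α)) (f := f)
      fun hle => hab (rel_of_forall_classFun fun x hx => (hfx x).1 (hle hx))
    rw [hC] at hC1
    have hF1 := finrank_inf_ker_of_not_le (U := classFun (cyc (detach σ a * α))) (f := f)
      fun hle => hab (cyc_mul_le_orbits _ _
        (rel_of_forall_classFun fun x hx => (hfx x).1 (hle hx)))
    have hle : classFun (cyc (σ * α)) ≤ LinearMap.ker f := fun y hy => (hfx y).2 <|
      eq_of_not_sameCycle (ψ := detach σ a * α) (φ := σ * α)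
        (fun h => hab (cyc_mul_le_orbits _ _ h))
        (fun d h1 h2 => by
          simp only [detach, Equiv.Perm.mul_apply] at h1 h2 ⊢
          rw [Equiv.swap_apply_def] at h1 h2 ⊢
          split_ifs at h1 h2 ⊢ <;> simp_all)
        (fun d h1 => by
          simp only [detach, Equiv.Perm.mul_apply] at h1 ⊢
          rw [Equiv.swap_apply_def] at h1
          split_ifs at h1 <;> simp_all) hy
    rw [hF, inf_eq_left.2 hle] at hF1
    simp only [eulerDefect]
    omega

theorem sum_fiber_eq_finrank (r : Setoid D) (k : ℕ) [DecidableRel r]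
    (h : ∀ d, (Finset.univ.filter fun e => r e d).card = k) :
    Fintype.card D = k * Module.finrank ℝ (classFun r) := by
  classical
  rw [finrank_classFun, Nat.card_eq_fintype_card, ← Finset.card_univ,
    Finset.card_eq_sum_card_fiberwise (f := fun d => Quotient.mk r d) (t := Finset.univ)
      (fun _ _ => Finset.mem_coe.2 (Finset.mem_univ _)), Finset.sum_const_nat (m := k),
    mul_comm, Finset.card_univ]
  intro q _
  induction q using Quotient.inductionOn with
  | h d =>
    rw [← h d]
    congr 1
    ext e
    simp [Quotient.eq]

theorem card_eq_two_mul_finrank {α : Equiv.Perm D} (hα : ∀ d, α (α d) = d) (hne : ∀ d, α d ≠ d) :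
    Fintype.card D = 2 * Module.finrank ℝ (classFun (cyc α)) := by
  classical
  refine sum_fiber_eq_finrank _ 2 fun d => ?_
  have : (Finset.univ.filter fun e => cyc α e d) = {d, α d} := by
    ext e
    simp [cyc_involution_iff hα]
  rw [this, Finset.card_pair (hne d).symm]

/-- Detaching every dart in turn never raises the defect and ends with a disjoint union of single
edges. There `V = 2E` and `C = F = E`, so the defect is zero. -/
theorem eulerDefect_nonneg {α : Equiv.Perm D} (hα : ∀ d, α (α d) = d) (hne : ∀ d, α d ≠ d)
    (σ : Equiv.Perm D) : 0 ≤ eulerDefect σ α := by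
  classical
  suffices ∀ (S : Finset D) (σ : Equiv.Perm D), (∀ d ∉ S, σ d = d) → 0 ≤ eulerDefect σ α from
    this Finset.univ σ (by simp)
  intro S
  induction S using Finset.induction_on with
  | empty =>
    intro σ h
    have h1 : σ = 1 := by ext d; simpa using h d (Finset.notMem_empty d)
    have h2 : cyc (1 : Equiv.Perm D) = ⊥ := by
      ext a b
      exact Equiv.Perm.sameCycle_one
    have h3 : classFun (⊥ : Setoid D) = ⊤ := eq_top_iff.2 fun x _ => (bot_le : ⊥ ≤ Setoid.ker x)
    subst h1
    rw [eulerDefect, orbits, one_mul, h2, bot_sup_eq, h3, finrank_top, Module.finrank_pi,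
      card_eq_two_mul_finrank hα hne]
    push_cast
    omega
  | insert a S _ ih =>
    intro σ h
    refine (ih (detach σ a) fun d hd => ?_).trans (eulerDefect_detach σ α a).1
    by_cases hda : d = a
    · rw [hda, detach_self]
    · exact detach_of_fixed (h d (by simp [hda, hd]))

end Defect

/-! ### Turning of closed polygons and of 1-forms along cycles. -/

section Turning

theorem abs_arg_mul_le (x y : ℂ) :
    |Complex.arg (x * y)| ≤ |Complex.arg x| + |Complex.arg y| := by
  rcases eq_or_ne x 0 with rfl | hx
  · simp
  rcases eq_or_ne y 0 with rfl | hy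
  · simp
  by_cases h : Complex.arg x + Complex.arg y ∈ Set.Ioc (-Real.pi) Real.pi
  · rw [Complex.arg_mul hx hy h]
    exact abs_add_le _ _
  · refine (Complex.abs_arg_le_pi _).trans (le_trans ?_ (abs_add_le _ _))
    by_contra! hlt
    exact h ⟨(abs_lt.1 hlt).1, (abs_lt.1 hlt).2.le⟩

theorem abs_arg_prod_le {ι : Type*} (s : Finset ι) (f : ι → ℂ) :
    |Complex.arg (∏ i ∈ s, f i)| ≤ ∑ i ∈ s, |Complex.arg (f i)| := by
  classical
  induction s using Finset.induction_on with
  | empty => simp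
  | insert a s ha ih =>
    rw [Finset.prod_insert ha, Finset.sum_insert ha]
    exact (abs_arg_mul_le _ _).trans (by gcongr)

theorem abs_arg_neg {x : ℂ} (hx : x ≠ 0) : |Complex.arg (-x)| = Real.pi - |Complex.arg x| := by
  rcases lt_trichotomy x.im 0 with h | h | h
  · rw [Complex.arg_neg_eq_arg_add_pi_of_im_neg h, abs_of_neg (Complex.arg_neg_iff.2 h),
      abs_of_nonneg (by linarith [Complex.neg_pi_lt_arg x])]
    ring
  · have hx' : x = (x.re : ℂ) := Complex.ext rfl (by simpa using h)
    have hre : x.re ≠ 0 := fun h0 => hx (by rw [hx', h0]; simp)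
    rw [hx']
    rcases lt_or_gt_of_ne hre with h1 | h1
    · rw [Complex.arg_ofReal_of_neg h1, ← Complex.ofReal_neg,
        Complex.arg_ofReal_of_nonneg (by linarith), abs_of_pos Real.pi_pos]
      simp
    · rw [Complex.arg_ofReal_of_nonneg h1.le, ← Complex.ofReal_neg,
        Complex.arg_ofReal_of_neg (by linarith), abs_of_pos Real.pi_pos]
      simp
  · rw [Complex.arg_neg_eq_arg_sub_pi_of_im_pos h,
      abs_of_nonneg (Complex.arg_nonneg_iff.2 h.le),
      abs_of_nonpos (by linarith [Complex.arg_le_pi x])]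
    ring

/-- A closed polygon with zero sum turns by at least `2π` (in the plane). -/
theorem two_pi_le_sum_abs_arg {w : ℕ → ℂ} {c : ℕ → ℝ} {m : ℕ} (hm : 0 < m) (hw : ∀ k, w k ≠ 0)
    (hc : ∀ k, 0 < c k) (hclosed : w m = w 0) (hsum : ∑ k ∈ Finset.range m, (c k : ℂ) * w k = 0) :
    2 * Real.pi ≤ ∑ k ∈ Finset.range m, |Complex.arg (w (k + 1) / w k)| := by
  by_contra! hlt
  set A := ∑ k ∈ Finset.range m, |Complex.arg (w (k + 1) / w k)|
  let Θ : ℕ → ℝ := fun k => ∑ j ∈ Finset.range k, Complex.arg (w (j + 1) / w j)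
  have hpolar : ∀ k, w k * ‖w 0‖ = w 0 * ‖w k‖ * Complex.exp (Θ k * Complex.I) := by
    intro k
    induction k with
    | zero => simp [Θ]
    | succ k ih =>
      have hn : (‖w k‖ : ℂ) ≠ 0 := by simpa using hw k
      have h1 := Complex.norm_mul_exp_arg_mul_I (w (k + 1) / w k)
      rw [norm_div, Complex.ofReal_div] at h1
      have h2 : w (k + 1) = w k * ((‖w (k + 1)‖ : ℂ) / ‖w k‖ *
          Complex.exp (Complex.arg (w (k + 1) / w k) * Complex.I)) := by
        rw [h1, mul_div_cancel₀ _ (hw k)]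
      have h3 : Complex.exp (Θ (k + 1) * Complex.I) = Complex.exp (Θ k * Complex.I) *
          Complex.exp (Complex.arg (w (k + 1) / w k) * Complex.I) := by
        rw [← Complex.exp_add]
        congr 1
        simp only [Θ, Finset.sum_range_succ]
        push_cast
        ring
      rw [h3]
      calc w (k + 1) * ‖w 0‖ = (w k * ‖w 0‖) * ((‖w (k + 1)‖ : ℂ) / ‖w k‖ *
            Complex.exp (Complex.arg (w (k + 1) / w k) * Complex.I)) := by
            rw [mul_right_comm, ← h2]
        _ = _ := by rw [ih]; field_simp
  have hw0 : (‖w 0‖ : ℂ) ≠ 0 := by simpa using hw 0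
  have hΘA : |Θ m| ≤ A := Finset.abs_sum_le_sum_abs _ _
  -- The polygon of directions closes up, so the lifted angle returns to a multiple of `2π`; total
  -- variation below `2π` leaves only zero.
  have hΘm : Θ m = 0 := by
    have h1 := hpolar m
    rw [hclosed] at h1
    have h2 : Complex.exp (Θ m * Complex.I) = 1 := by
      have : w 0 * ‖w 0‖ ≠ 0 := mul_ne_zero (hw 0) hw0
      exact mul_left_cancel₀ this (by rw [← h1, mul_one])
    obtain ⟨n, hn⟩ := Complex.exp_eq_one_iff.1 h2
    have h3 : Θ m = n * (2 * Real.pi) := by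
      have := congrArg Complex.im hn
      simpa using this
    have h4 : |(n : ℝ)| < 1 := by
      rw [h3, abs_mul, abs_of_pos Real.two_pi_pos] at hΘA
      by_contra! h5
      nlinarith [Real.two_pi_pos]
    have h5 : n = 0 := by
      rw [← Int.abs_lt_one_iff]
      exact_mod_cast h4
    rw [h3, h5]
    simp
  -- The loop passes from `k` to `l` in two complementary ways, and the two variations together make
  -- up `A`.
  have hosc : ∀ k l, k ≤ l → l ≤ m → 2 * |Θ l - Θ k| ≤ A := by
    intro k l hkl hlm
    have h1 : Θ l - Θ k = ∑ j ∈ Finset.Ico k l, Complex.arg (w (j + 1) / w j) :=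
      (Finset.sum_Ico_eq_sub _ hkl).symm
    have h2 : Θ l - Θ k = -(∑ j ∈ Finset.range k, Complex.arg (w (j + 1) / w j) +
        ∑ j ∈ Finset.Ico l m, Complex.arg (w (j + 1) / w j)) := by
      rw [Finset.sum_Ico_eq_sub _ hlm]
      change _ = -(Θ k + (Θ m - Θ l))
      rw [hΘm]; ring
    have h3 : |Θ l - Θ k| ≤ ∑ j ∈ Finset.Ico k l, |Complex.arg (w (j + 1) / w j)| := by
      rw [h1]; exact Finset.abs_sum_le_sum_abs _ _
    have h4 : |Θ l - Θ k| ≤ ∑ j ∈ Finset.range k, |Complex.arg (w (j + 1) / w j)| +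
        ∑ j ∈ Finset.Ico l m, |Complex.arg (w (j + 1) / w j)| := by
      rw [h2, abs_neg]
      exact (abs_add_le _ _).trans
        (add_le_add (Finset.abs_sum_le_sum_abs _ _) (Finset.abs_sum_le_sum_abs _ _))
    have h5 : A = ∑ j ∈ Finset.range k, |Complex.arg (w (j + 1) / w j)| +
        ∑ j ∈ Finset.Ico k l, |Complex.arg (w (j + 1) / w j)| +
        ∑ j ∈ Finset.Ico l m, |Complex.arg (w (j + 1) / w j)| := by
      rw [Finset.sum_range_add_sum_Ico _ hkl, Finset.sum_range_add_sum_Ico _ hlm]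
    linarith
  have hosc' : ∀ k l, k < m → l < m → 2 * |Θ l - Θ k| ≤ A := by
    intro k l hk hl
    rcases le_total k l with h | h
    · exact hosc k l h hl.le
    · rw [abs_sub_comm]; exact hosc l k h hk.le
  have hne : (Finset.range m).Nonempty := Finset.nonempty_range_iff.2 hm.ne'
  obtain ⟨a, ha, hamin⟩ := Finset.exists_min_image (Finset.range m) Θ hne
  obtain ⟨b, hb, hbmax⟩ := Finset.exists_max_image (Finset.range m) Θ hne
  have hab := hosc' a b (Finset.mem_range.1 ha) (Finset.mem_range.1 hb)
  rw [abs_of_nonneg (by linarith [hamin b hb])] at hab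
  -- All lifted angles lie within `A / 4 < π / 2` of the midpoint `μ`. So all vectors point into one
  -- open half-plane and no positive combination of them vanishes.
  set μ := (Θ a + Θ b) / 2 with hμ
  have hpos : ∀ k ∈ Finset.range m, 0 < c k * (‖w k‖ * Real.cos (Θ k - μ)) := by
    intro k hk
    refine mul_pos (hc k) (mul_pos (norm_pos_iff.2 (hw k)) (Real.cos_pos_of_mem_Ioo ⟨?_, ?_⟩))
    · linarith [hamin k hk]
    · linarith [hbmax k hk]
  have hzero : ∑ k ∈ Finset.range m, c k * (‖w k‖ * Real.cos (Θ k - μ)) = 0 := by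
    have h1 : ∑ k ∈ Finset.range m, (c k : ℂ) * (‖w k‖ * Complex.exp ((Θ k - μ : ℝ) * Complex.I))
        = 0 := by
      have : ∀ k, (c k : ℂ) * (‖w k‖ * Complex.exp ((Θ k - μ : ℝ) * Complex.I)) =
          ((c k : ℂ) * w k) * (‖w 0‖ / w 0 * Complex.exp (-(μ * Complex.I))) := by
        intro k
        have h0 := hpolar k
        have hexp : Complex.exp ((Θ k - μ : ℝ) * Complex.I) =
            Complex.exp (Θ k * Complex.I) * Complex.exp (-(μ * Complex.I)) := by
          rw [← Complex.exp_add]; congr 1; push_cast; ring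
        rw [hexp]
        have h00 := hw 0
        calc _ = (c k : ℂ) * (w 0 * ‖w k‖ * Complex.exp (Θ k * Complex.I)) / w 0 *
                Complex.exp (-(μ * Complex.I)) := by field_simp
          _ = _ := by rw [← h0]; ring
      rw [Finset.sum_congr rfl fun k _ => this k, ← Finset.sum_mul, hsum, zero_mul]
    have h2 := congrArg Complex.re h1
    rw [Complex.re_sum] at h2
    simpa only [Complex.re_ofReal_mul, Complex.exp_ofReal_mul_I_re, Complex.zero_re] using h2
  exact (Finset.sum_pos hpos hne).ne' hzero

variable {D : Type*} [Fintype D]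

theorem prod_cycle_eq_prod_range {M : Type*} [CommMonoid M] (ψ : Equiv.Perm D)
    [DecidableRel (cyc ψ)] (d₀ : D) (g : D → M) :
    ∏ d with cyc ψ d d₀, g d = ∏ k ∈ Finset.range (Function.minimalPeriod ψ d₀), g (ψ^[k] d₀) := by
  have hper : 0 < Function.minimalPeriod ψ d₀ :=
    Function.minimalPeriod_pos_of_mem_periodicPts
      (ψ.injective.mem_periodicPts d₀)
  symm
  refine Finset.prod_bij (fun k _ => ψ^[k] d₀) ?_ ?_ ?_ (fun _ _ => rfl)
  · intro k _
    simp only [Finset.mem_filter, Finset.mem_univ, true_and]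
    exact Setoid.symm' _ ⟨k, by rw [zpow_natCast, Equiv.Perm.iterate_eq_pow]⟩
  · intro k hk l hl h
    exact Function.iterate_injOn_Iio_minimalPeriod (Finset.mem_range.1 hk) (Finset.mem_range.1 hl) h
  · intro d hd
    simp only [Finset.mem_filter, Finset.mem_univ, true_and] at hd
    have hs : ψ.SameCycle d₀ d := Setoid.symm' _ hd
    obtain ⟨n, hn⟩ := hs.exists_nat_pow_eq
    refine ⟨n % Function.minimalPeriod ψ d₀, Finset.mem_range.2 (Nat.mod_lt _ hper), ?_⟩
    rw [Function.iterate_mod_minimalPeriod_eq, ← hn, Equiv.Perm.iterate_eq_pow]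

theorem sum_cycle_eq_sum_range {M : Type*} [AddCommMonoid M] (ψ : Equiv.Perm D)
    [DecidableRel (cyc ψ)] (d₀ : D) (g : D → M) :
    ∑ d with cyc ψ d d₀, g d = ∑ k ∈ Finset.range (Function.minimalPeriod ψ d₀), g (ψ^[k] d₀) :=
  prod_cycle_eq_prod_range (M := Multiplicative M) ψ d₀ g

/-- The factors `ω` cancel in the product of the turning ratios around the cycle, which leaves the
inverse monodromy. Its argument is at most the sum of the turnings. -/
theorem abs_arg_monodromy_le (ψ : Equiv.Perm D)
    [DecidableRel (cyc ψ)] (d₀ : D) (s : D → ℂˣ) (ω : D → ℂ)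
    (hω : ∀ d, cyc ψ d d₀ → ω d ≠ 0) :
    |Complex.arg ((∏ d with cyc ψ d d₀, s d : ℂˣ) : ℂ)| ≤
      ∑ d with cyc ψ d d₀, |Complex.arg (ω (ψ d) / (s d * ω d))| := by
  have h1 : ∏ d with cyc ψ d d₀, ω (ψ d) = ∏ d with cyc ψ d d₀, ω d := by
    refine Finset.prod_bij (fun d _ => ψ d) ?_ (fun _ _ _ _ h => ψ.injective h) ?_ (fun _ _ => rfl)
    · intro d hd
      simp only [Finset.mem_filter, Finset.mem_univ, true_and] at hd ⊢
      exact Setoid.trans' _ (cyc_apply ψ d) hd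
    · intro d hd
      simp only [Finset.mem_filter, Finset.mem_univ, true_and] at hd
      refine ⟨ψ⁻¹ d, ?_, by simp⟩
      simp only [Finset.mem_filter, Finset.mem_univ, true_and]
      refine Setoid.trans' _ (Setoid.symm' _ (cyc_apply ψ _)) ?_
      simpa using hd
  have h2 : ∏ d with cyc ψ d d₀, (ω (ψ d) / (s d * ω d)) =
      ((∏ d with cyc ψ d d₀, s d : ℂˣ) : ℂ)⁻¹ := by
    rw [Finset.prod_div_distrib, Finset.prod_mul_distrib, h1, Units.coe_prod]
    have : ∏ d with cyc ψ d d₀, ω d ≠ 0 := Finset.prod_ne_zero_iff.2 fun d hd => by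
      simp only [Finset.mem_filter, Finset.mem_univ, true_and] at hd
      exact hω d hd
    rw [mul_comm, div_mul_cancel_left₀ this]
  rw [← Complex.abs_arg_inv, ← h2]
  exact abs_arg_prod_le _ _

/-- Transport all values of `ω` back to the fibre at `d₀`. Trivial monodromy makes the resulting
polygon of directions closed, and the turning angles do not depend on the transport. -/
theorem two_pi_le_turning (ψ : Equiv.Perm D)
    [DecidableRel (cyc ψ)] (d₀ : D) (s : D → ℂˣ) (ω : D → ℂ) (c : D → ℝ)
    (hω : ∀ d, cyc ψ d d₀ → ω d ≠ 0) (hc : ∀ d, 0 < c d) (hs : ∏ d with cyc ψ d d₀, s d = 1)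
    (hsum : ∑ k ∈ Finset.range (Function.minimalPeriod ψ d₀),
      (c (ψ^[k] d₀) : ℂ) * ((∏ j ∈ Finset.range k, s (ψ^[j] d₀) : ℂˣ)⁻¹ * ω (ψ^[k] d₀)) = 0) :
    2 * Real.pi ≤ ∑ d with cyc ψ d d₀, |Complex.arg (ω (ψ d) / (s d * ω d))| := by
  have hper : 0 < Function.minimalPeriod ψ d₀ :=
    Function.minimalPeriod_pos_of_mem_periodicPts (ψ.injective.mem_periodicPts d₀)
  have hω' : ∀ k, ω (ψ^[k] d₀) ≠ 0 := fun k =>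
    hω _ (Setoid.symm' _ ⟨k, by rw [zpow_natCast, Equiv.Perm.iterate_eq_pow]⟩)
  rw [prod_cycle_eq_prod_range] at hs
  rw [sum_cycle_eq_sum_range]
  refine (two_pi_le_sum_abs_arg hper (fun k => ?_) (fun k => hc (ψ^[k] d₀)) ?_ hsum).trans
    (le_of_eq (Finset.sum_congr rfl fun k _ => ?_))
  · exact mul_ne_zero (Units.ne_zero _) (hω' k)
  · rw [hs, Function.iterate_minimalPeriod]
    simp
  · congr 2
    rw [Finset.prod_range_succ, Function.iterate_succ_apply']
    have := Units.ne_zero (∏ j ∈ Finset.range k, s (ψ^[j] d₀))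
    have h1 := hω' k
    have h2 := Units.ne_zero (s (ψ^[k] d₀))
    simp only [mul_inv_rev, Units.val_mul, Units.val_inv_eq_inv_val]
    field_simp

end Turning

/-! ### Control of face monodromies through the oscillation of face functions. -/

section Oscillation

open Classical

variable {D : Type*}

theorem orbits_detach_le (σ α : Equiv.Perm D) (a : D) : orbits (detach σ a) α ≤ orbits σ α := by
  intro c d h
  refine rel_of_forall_classFun fun x hx => ?_
  rw [← classFun_orbits_detach_inf_ker (a := a)] at hx
  exact mem_classFun.1 hx.1 _ _ h

variable [Fintype D]

theorem sum_eq_sum_quotient {M : Type*} [AddCommMonoid M] (r : Setoid D) (g : D → M) :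
    ∑ d, g d = ∑ q : Quotient r, ∑ d with r d q.out, g d := by
  rw [← Finset.sum_fiberwise Finset.univ (fun d => Quotient.mk r d) g]
  refine Finset.sum_congr rfl fun q _ => Finset.sum_congr ?_ fun _ _ => rfl
  ext d
  simp only [Finset.mem_filter, Finset.mem_univ, true_and]
  conv_lhs => rw [← Quotient.out_eq q]
  exact Quotient.eq

theorem sum_class_eq_zero {α : Equiv.Perm D} {r : Setoid D} (hr : ∀ d, r (α d) d) {n : D → ℝ}
    (hn : ∀ d, n (α d) = -n d) (d₀ : D) : ∑ d with r d d₀, n d = 0 := by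
  have : ∑ d with r d d₀, n d = ∑ d with r d d₀, -n d := by
    symm
    refine Finset.sum_bij (fun d _ => α d) ?_ (fun _ _ _ _ h => α.injective h) ?_
      (fun d _ => (hn d).symm)
    · intro d hd
      simp only [Finset.mem_filter, Finset.mem_univ, true_and] at hd ⊢
      exact r.trans (hr d) hd
    · intro d hd
      simp only [Finset.mem_filter, Finset.mem_univ, true_and] at hd
      refine ⟨α⁻¹ d, ?_, by simp⟩
      simp only [Finset.mem_filter, Finset.mem_univ, true_and]
      refine r.trans (r.symm (hr _)) ?_
      simpa using hd
  rw [Finset.sum_neg_distrib] at this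
  linarith

/-- On every component, the pairing of the 1-cochain `n` with a function on the faces is at most
the oscillation of that function. -/
def OscillationBound (σ α : Equiv.Perm D) (n : D → ℝ) : Prop :=
  ∀ d₀, ∀ y ∈ classFun (cyc (σ * α)), ∀ lo hi : ℝ,
    (∀ d, orbits σ α d d₀ → lo ≤ y d ∧ y d ≤ hi) →
      |∑ d with orbits σ α d d₀, n d * y d| ≤ hi - lo

/-- A face function on a component of the detached map is extended by a constant to a face function
of the old map with the same bounds. The constant pairs to zero with `n`, which is antisymmetric. -/
theorem OscillationBound.detach {σ α : Equiv.Perm D} {n : D → ℝ} (h : OscillationBound σ α n)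
    (hn : ∀ d, n (α d) = -n d) {a : D}
    (hdef : eulerDefect σ α ≤ eulerDefect (detach σ a) α) :
    OscillationBound (detach σ a) α n := by
  intro d₀ y hy lo hi hb
  set r := orbits (_root_.detach σ a) α with hr
  have hstar := (eulerDefect_detach σ α a).2 hdef
  let k : ℝ := if r a d₀ then y a else if r (σ a) d₀ then y (σ a) else y d₀
  have hk : lo ≤ k ∧ k ≤ hi := by
    simp only [k]
    split_ifs with h1 h2
    · exact hb _ h1
    · exact hb _ h2
    · exact hb _ (r.refl _)
  let y' : D → ℝ := fun d => if r d d₀ then y d else k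
  have hy'1 : y' ∈ classFun (cyc (_root_.detach σ a * α)) := by
    rw [mem_classFun_cyc] at hy ⊢
    intro d
    have h1 : r ((_root_.detach σ a * α) d) d :=
      cyc_mul_le_orbits _ _ (cyc_apply _ d)
    have h2 : r ((_root_.detach σ a * α) d) d₀ ↔ r d d₀ :=
      ⟨fun h => r.trans (r.symm h1) h, fun h => r.trans h1 h⟩
    simp only [y', h2, hy]
  have hy'2 : y' a = y' (σ a) := by
    simp only [y', k]
    by_cases h1 : r a d₀ <;> by_cases h2 : r (σ a) d₀ <;> simp only [h1, h2, if_true, if_false]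
    exact hstar (r.trans h1 (r.symm h2)) y hy
  have hy' : y' ∈ classFun (cyc (σ * α)) := by
    have : y' ∈ classFun (cyc (_root_.detach σ a * α)) ⊓ LinearMap.ker (evalSub a (σ a)) :=
      ⟨hy'1, mem_ker_evalSub.2 hy'2⟩
    rw [classFun_cyc_detach_inf_ker] at this
    exact this.1
  have hmain := h d₀ y' hy' lo hi fun d _ => by
    simp only [y']
    split_ifs with h1
    · exact hb _ h1
    · exact hk
  convert hmain using 2
  have h1 : ∀ d, n d * y' d = (if r d d₀ then n d * y d - k * n d else 0) + k * n d := by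
    intro d
    simp only [y']
    split_ifs <;> ring
  have h2 : (Finset.univ.filter fun d => orbits σ α d d₀).filter (fun d => r d d₀) =
      Finset.univ.filter fun d => r d d₀ := by
    ext d
    simp only [Finset.mem_filter, Finset.mem_univ, true_and, and_iff_right_iff_imp]
    exact fun h => orbits_detach_le σ α a h
  rw [Finset.sum_congr rfl fun d _ => h1 d, Finset.sum_add_distrib, ← Finset.mul_sum,
    sum_class_eq_zero (orbits_right σ α) hn, ← Finset.sum_filter, h2, Finset.sum_sub_distrib,
    ← Finset.mul_sum, sum_class_eq_zero (orbits_right _ α) hn]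
  ring

theorem sum_mul_eq_sub {r : Setoid D} {n : D → ℝ} {a b : D}
    (h : ∀ d₀, ∑ d with r d d₀, n d = (if r a d₀ then 1 else 0) - (if r b d₀ then 1 else 0))
    {y : D → ℝ} (hy : y ∈ classFun r) : ∑ d, n d * y d = y a - y b := by
  have h1 : ∀ q : Quotient r, ∑ d with r d q.out, n d * y d =
      (if Quotient.mk r a = q then y a else 0) - (if Quotient.mk r b = q then y b else 0) := by
    intro q
    have h2 : ∑ d with r d q.out, n d * y d = ∑ d with r d q.out, n d * y q.out :=
      Finset.sum_congr rfl fun d hd => by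
        simp only [Finset.mem_filter, Finset.mem_univ, true_and] at hd
        rw [mem_classFun.1 hy _ _ hd]
    have h3 : ∀ c, Quotient.mk r c = q ↔ r c q.out := fun c => by
      conv_lhs => rw [← Quotient.out_eq q]
      exact Quotient.eq
    simp only [h2, ← Finset.sum_mul, h, h3]
    split_ifs with h4 h5 h5
    · rw [mem_classFun.1 hy _ _ h4, mem_classFun.1 hy _ _ h5]; ring
    · rw [mem_classFun.1 hy _ _ h4]; ring
    · rw [mem_classFun.1 hy _ _ h5]; ring
    · ring
  rw [sum_eq_sum_quotient r, Finset.sum_congr rfl fun q _ => h1 q, Finset.sum_sub_distrib]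
  simp

/-- Starting point of the detaching process: for coboundary "face of `a` minus face of `b`" the
pairing is just `y a - y b`. -/
theorem OscillationBound.of_top {σ α : Equiv.Perm D} (htop : orbits σ α = ⊤) {n : D → ℝ} {a b : D}
    (h : ∀ d₀, ∑ d with cyc (σ * α) d d₀, n d =
      (if cyc (σ * α) a d₀ then 1 else 0) - (if cyc (σ * α) b d₀ then 1 else 0)) :
    OscillationBound σ α n := by
  intro d₀ y hy lo hi hb
  have h1 : ∀ d, orbits σ α d d₀ := fun d => by rw [htop]; trivial
  have h2 : (Finset.univ.filter fun d => orbits σ α d d₀) = Finset.univ :=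
    Finset.filter_true_of_mem fun d _ => h1 d
  rw [h2, sum_mul_eq_sub h hy]
  have ha := hb a (h1 a)
  have hbb := hb b (h1 b)
  rw [abs_le]
  constructor <;> linarith [ha.1, ha.2, hbb.1, hbb.2]

end Oscillation

/-! ### The Gauss-Bonnet count. -/

section Rigidity

theorem prod_zpow_eq_zpow_sum {ι G : Type*} [CommGroup G] (s : Finset ι) (z : G) (n : ι → ℤ) :
    ∏ i ∈ s, z ^ n i = z ^ ∑ i ∈ s, n i := by
  classical
  induction s using Finset.induction_on with
  | empty => simp
  | insert a s ha ih => rw [Finset.prod_insert ha, Finset.sum_insert ha, ih, zpow_add]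

open Classical

variable {D : Type*} [Fintype D]

/-- On a planar map, a nonzero 1-form with values in a flat line bundle of monodromy `z` that
turns by at least `2π` around every vertex and every face of trivial monodromy can
only exist if `arg z = 0`. -/
theorem form_eq_zero_of_arg_ne_zero {σ α : Equiv.Perm D} (hα : ∀ d, α (α d) = d)
    (hne : ∀ d, α d ≠ d) (hdef : eulerDefect σ α ≤ 0) {n : D → ℤ} (hn : ∀ d, n (α d) = -n d)
    (hosc : OscillationBound σ α fun d => (n d : ℝ)) {z : ℂˣ} (hz : Complex.arg z ≠ 0) {ω : D → ℂ}
    (hω : ∀ d, ω (α d) = -((z ^ n d : ℂˣ) : ℂ) * ω d) (hfix : ∀ d, ω d = 0 → σ d = d)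
    (hvertex : ∀ d₀, ω d₀ ≠ 0 →
      2 * Real.pi ≤ ∑ d with cyc σ d d₀, |Complex.arg (ω (σ d) / ω d)|)
    (hface : ∀ d₀, (∀ d, cyc (σ * α) d d₀ → ω d ≠ 0) → ∑ d with cyc (σ * α) d d₀, n d = 0 →
      2 * Real.pi ≤ ∑ d with cyc (σ * α) d d₀,
        |Complex.arg (ω ((σ * α) d) / ((z ^ n d : ℂˣ) * ω d))|) (d : D) : ω d = 0 := by
  by_contra hd
  have hπ := Real.pi_pos
  set θ := |Complex.arg z| with hθ
  have hθ0 : 0 < θ := abs_pos.2 hz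
  have hθπ : θ ≤ Real.pi := Complex.abs_arg_le_pi _
  have hωα : ∀ d, ω (α d) = 0 ↔ ω d = 0 := fun d => by
    rw [hω, mul_eq_zero, neg_eq_zero, or_iff_right (Units.ne_zero _)]
  have hωσ : ∀ d, ω (σ d) = 0 ↔ ω d = 0 := fun d =>
    ⟨fun h => by rwa [← σ.injective (hfix _ h)], fun h => by rwa [hfix _ h]⟩
  have hzero : ∀ d e, orbits σ α d e → (ω d = 0 ↔ ω e = 0) := by
    intro d e h
    have hx : (fun d => if ω d = 0 then (1 : ℝ) else 0) ∈ classFun (orbits σ α) :=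
      mem_classFun_orbits.2 ⟨fun d => by simp only [hωσ], fun d => by simp only [hωα]⟩
    have := mem_classFun.1 hx _ _ h
    by_cases h1 : ω d = 0 <;> by_cases h2 : ω e = 0 <;> simp_all
  have hzclass : ∀ d e, ω e = 0 → orbits σ α d e → d = e ∨ d = α e := by
    intro d e he h
    have hx : (fun d => if d = e ∨ d = α e then (1 : ℝ) else 0) ∈ classFun (orbits σ α) := by
      refine mem_classFun_orbits.2 ⟨fun d => ?_, fun d => ?_⟩
      · have h1 : σ d = e ↔ d = e :=
          ⟨fun h => σ.injective (h.trans (hfix e he).symm), fun h => by rw [h, hfix e he]⟩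
        have h2 : σ d = α e ↔ d = α e :=
          ⟨fun h => σ.injective (h.trans (hfix _ ((hωα e).2 he)).symm),
            fun h => by rw [h, hfix _ ((hωα e).2 he)]⟩
        simp only [h1, h2]
      · have h1 : α d = e ↔ d = α e := ⟨fun h => by rw [← h, hα], fun h => by rw [h, hα]⟩
        have h2 : α d = α e ↔ d = e := α.injective.eq_iff
        simp only [h1, h2, or_comm]
    have := mem_classFun.1 hx _ _ h
    by_contra hc
    simp [hc] at this
  have hzface : ∀ e, ω e = 0 → (Finset.univ.filter fun d => cyc (σ * α) d e) = {e, α e} := by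
    intro e he
    ext d
    simp only [Finset.mem_filter, Finset.mem_univ, true_and, Finset.mem_insert,
      Finset.mem_singleton]
    refine ⟨fun h => hzclass d e he (cyc_mul_le_orbits _ _ h), ?_⟩
    rintro (rfl | rfl)
    · exact Setoid.refl' _ _
    · have := cyc_apply (σ * α) e
      rwa [Equiv.Perm.mul_apply, hfix _ ((hωα e).2 he)] at this
  let N : D → ℤ := fun d => ∑ e with cyc (σ * α) e d, n e
  have hNclass : ∀ d e, cyc (σ * α) d e → N d = N e := by
    intro d e h
    refine Finset.sum_congr (Finset.filter_congr fun c _ => ?_) fun _ _ => rfl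
    exact ⟨fun h' => Setoid.trans' _ h' h, fun h' => Setoid.trans' _ h' (Setoid.symm' _ h)⟩
  -- Oscillation bound for the indicator of a single face.
  have hN1 : ∀ d, |N d| ≤ 1 := by
    intro d₀
    have hy : (fun d => if cyc (σ * α) d d₀ then (1 : ℝ) else 0) ∈ classFun (cyc (σ * α)) := by
      refine mem_classFun.2 fun a b hab => ?_
      have : cyc (σ * α) a d₀ ↔ cyc (σ * α) b d₀ :=
        ⟨fun h => Setoid.trans' _ (Setoid.symm' _ hab) h, fun h => Setoid.trans' _ hab h⟩
      simp only [this]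
    have h1 := hosc d₀ _ hy 0 1 fun d _ => by split_ifs <;> norm_num
    have h2 : (Finset.univ.filter fun d => orbits σ α d d₀).filter (fun d => cyc (σ * α) d d₀) =
        Finset.univ.filter fun d => cyc (σ * α) d d₀ := by
      ext d
      simp only [Finset.mem_filter, Finset.mem_univ, true_and, and_iff_right_iff_imp]
      exact fun h => cyc_mul_le_orbits σ α h
    simp only [mul_ite, mul_one, mul_zero] at h1
    rw [← Finset.sum_filter, h2] at h1
    have h3 : |((N d₀ : ℤ) : ℝ)| ≤ 1 := by
      simp only [N]
      push_cast
      linarith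
    exact_mod_cast h3
  -- Pairing `n` with this sign function gives the sum of the `|N|` over the faces. Its oscillation
  -- is at most two, so each component carries at most two faces of nontrivial exponent.
  let s : D → ℝ := fun d => ((N d).sign : ℝ)
  have hs : s ∈ classFun (cyc (σ * α)) := mem_classFun.2 fun a b hab => by
    simp only [s, hNclass a b hab]
  have hs1 : ∀ d, -1 ≤ s d ∧ s d ≤ 1 := fun d => by
    have h1 : -1 ≤ (N d).sign ∧ (N d).sign ≤ 1 := by
      rcases Int.sign_trichotomy (N d) with h | h | h <;> rw [h] <;> norm_num
    simp only [s]
    exact ⟨by exact_mod_cast h1.1, by exact_mod_cast h1.2⟩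
  have hns : ∀ d₀, ∑ d with cyc (σ * α) d d₀, (n d : ℝ) * s d = |((N d₀ : ℤ) : ℝ)| := by
    intro d₀
    have h1 : ∑ d with cyc (σ * α) d d₀, (n d : ℝ) * s d =
        ∑ d with cyc (σ * α) d d₀, (n d : ℝ) * s d₀ := Finset.sum_congr rfl fun d hd => by
      simp only [Finset.mem_filter, Finset.mem_univ, true_and] at hd
      simp only [s, hNclass _ _ hd]
    rw [h1, ← Finset.sum_mul, ← Int.cast_sum]
    change ((N d₀ : ℤ) : ℝ) * ((N d₀).sign : ℝ) = _
    exact_mod_cast Int.mul_sign_self (N d₀)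
  -- Where `ω` vanishes, the component is an isolated edge with two vertices and one face. The
  -- default values `2π` here and `π` in `gf` give each of these a total of `2π`.
  let gv : D → ℝ := fun d => if ω d = 0 then 2 * Real.pi else |Complex.arg (ω (σ d) / ω d)|
  let gf : D → ℝ := fun d => if ω d = 0 then Real.pi else
    |Complex.arg (ω ((σ * α) d) / ((z ^ n d : ℂˣ) * ω d))|
  have hgv : ∀ d₀, 2 * Real.pi ≤ ∑ d with cyc σ d d₀, gv d := by
    intro d₀
    by_cases h0 : ω d₀ = 0
    · have h1 : gv d₀ = 2 * Real.pi := if_pos h0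
      rw [← h1]
      refine Finset.single_le_sum (f := gv) (fun d _ => ?_) (by simp)
      simp only [gv]
      split_ifs <;> positivity
    · refine (hvertex d₀ h0).trans (le_of_eq (Finset.sum_congr rfl fun d hd => ?_))
      simp only [Finset.mem_filter, Finset.mem_univ, true_and] at hd
      have := (hzero d d₀ ((le_sup_left : cyc σ ≤ orbits σ α) hd)).not.2 h0
      simp only [gv, this, if_false]
  have hgf : ∀ d₀, 2 * Real.pi - (2 * Real.pi - θ) * ∑ d with cyc (σ * α) d d₀, (n d : ℝ) * s d ≤
      ∑ d with cyc (σ * α) d d₀, gf d := by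
    intro d₀
    rw [hns]
    by_cases h0 : ω d₀ = 0
    · have h1 : ∑ d with cyc (σ * α) d d₀, gf d = 2 * Real.pi := by
        rw [hzface d₀ h0, Finset.sum_pair (hne d₀).symm]
        simp only [gf, (hωα d₀).2 h0, h0, if_true]
        ring
      rw [h1]
      have : 0 ≤ (2 * Real.pi - θ) * |((N d₀ : ℤ) : ℝ)| :=
        mul_nonneg (by linarith) (abs_nonneg _)
      linarith
    · have h1 : ∀ d, cyc (σ * α) d d₀ → ω d ≠ 0 := fun d hd =>
        (hzero d d₀ (cyc_mul_le_orbits σ α hd)).not.2 h0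
      have h2 : ∑ d with cyc (σ * α) d d₀, gf d = ∑ d with cyc (σ * α) d d₀,
          |Complex.arg (ω ((σ * α) d) / ((z ^ n d : ℂˣ) * ω d))| :=
        Finset.sum_congr rfl fun d hd => by
          simp only [Finset.mem_filter, Finset.mem_univ, true_and] at hd
          simp only [gf, h1 d hd, if_false]
      rw [h2]
      have h3 := abs_arg_monodromy_le (σ * α) d₀ (fun d => z ^ n d) ω h1
      rw [prod_zpow_eq_zpow_sum] at h3
      change |Complex.arg ((z ^ N d₀ : ℂˣ) : ℂ)| ≤ _ at h3
      rcases Int.abs_le_one_iff.1 (hN1 d₀) with h4 | h4 | h4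
      · have := hface d₀ h1 h4
        simpa [h4] using this
      · rw [h4] at h3 ⊢
        simp only [zpow_one] at h3
        rw [show |((1 : ℤ) : ℝ)| = 1 by norm_num]
        linarith
      · rw [h4] at h3 ⊢
        simp only [zpow_neg, zpow_one, Units.val_inv_eq_inv_val, Complex.abs_arg_inv] at h3
        rw [show |((-1 : ℤ) : ℝ)| = 1 by norm_num]
        linarith
  -- Reversing a dart negates the transported form, so the vertex angle and the face angle at a
  -- corner are supplementary. An isolated dart has an excess of `2π`.
  have hcorner : ∀ d, gv (α d) + gf d = Real.pi + if ω d = 0 then 2 * Real.pi else 0 := by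
    intro d
    by_cases h0 : ω d = 0
    · simp only [gv, gf, h0, (hωα d).2 h0, if_true]
      ring
    · have h1 := (hωα d).not.2 h0
      have h2 : ω ((σ * α) d) / ((z ^ n d : ℂˣ) * ω d) = -(ω (σ (α d)) / ω (α d)) := by
        rw [hω d, Equiv.Perm.mul_apply, neg_mul, div_neg, neg_neg]
      simp only [gv, gf, h0, h1, if_false, h2]
      rw [abs_arg_neg (div_ne_zero ((hωσ _).not.2 h1) h1)]
      ring
  -- An isolated edge uses up exactly `4π`. Any other component uses at most `2(2π - θ)`, strictly
  -- less since `θ > 0`; a single such component therefore gives the contradiction.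
  have hcomp : ∀ d₀, ∑ d with orbits σ α d d₀,
      ((if ω d = 0 then 2 * Real.pi else 0) + (2 * Real.pi - θ) * (n d * s d)) ≤ 4 * Real.pi ∧
      (ω d₀ ≠ 0 → ∑ d with orbits σ α d d₀,
      ((if ω d = 0 then 2 * Real.pi else 0) + (2 * Real.pi - θ) * (n d * s d)) < 4 * Real.pi) := by
    intro d₀
    rw [Finset.sum_add_distrib, ← Finset.mul_sum]
    by_cases h0 : ω d₀ = 0
    · refine ⟨?_, fun h => absurd h0 h⟩
      have h1 : (Finset.univ.filter fun d => orbits σ α d d₀) = {d₀, α d₀} := by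
        ext d
        simp only [Finset.mem_filter, Finset.mem_univ, true_and, Finset.mem_insert,
          Finset.mem_singleton]
        refine ⟨fun h => hzclass d d₀ h0 h, ?_⟩
        rintro (rfl | rfl)
        · exact Setoid.refl' _ _
        · exact orbits_right σ α d₀
      have h2 := hns d₀
      rw [hzface d₀ h0] at h2
      have h3 : N d₀ = 0 := by
        simp only [N]
        rw [hzface d₀ h0, Finset.sum_pair (hne d₀).symm, hn]
        ring
      rw [h1, h2, h3, Finset.sum_pair (hne d₀).symm]
      simp only [h0, (hωα d₀).2 h0, if_true]
      simp
      linarith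
    · have h1 := hosc d₀ s hs (-1) 1 fun d _ => hs1 d
      have h2 := (abs_le.1 h1).2
      have h3 : ∑ d with orbits σ α d d₀, (if ω d = 0 then 2 * Real.pi else 0) = 0 :=
        Finset.sum_eq_zero fun d hd => by
          simp only [Finset.mem_filter, Finset.mem_univ, true_and] at hd
          rw [if_neg ((hzero d d₀ hd).not.2 h0)]
      rw [h3]
      have h4 : 0 + (2 * Real.pi - θ) * ∑ d with orbits σ α d d₀, (n d : ℝ) * s d
          < 4 * Real.pi := by nlinarith
      exact ⟨h4.le, fun _ => h4⟩
  have htotal : ∑ d, gv d + ∑ d, gf d =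
      ∑ d, (Real.pi + if ω d = 0 then 2 * Real.pi else 0) := by
    rw [← Equiv.sum_comp α gv, ← Finset.sum_add_distrib]
    exact Finset.sum_congr rfl fun d _ => hcorner d
  have hV : 2 * Real.pi * Module.finrank ℝ (classFun (cyc σ)) ≤ ∑ d, gv d := by
    rw [sum_eq_sum_quotient (cyc σ), finrank_classFun, Nat.card_eq_fintype_card, mul_comm,
      ← nsmul_eq_mul]
    exact Finset.card_nsmul_le_sum _ _ _ fun q _ => hgv _
  have hF : 2 * Real.pi * Module.finrank ℝ (classFun (cyc (σ * α))) -
      (2 * Real.pi - θ) * ∑ d, (n d : ℝ) * s d ≤ ∑ d, gf d := by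
    rw [sum_eq_sum_quotient (cyc (σ * α)), sum_eq_sum_quotient (cyc (σ * α)) gf, finrank_classFun,
      Nat.card_eq_fintype_card, mul_comm (2 * Real.pi), ← nsmul_eq_mul, Finset.mul_sum]
    have h1 : Fintype.card (Quotient (cyc (σ * α))) • (2 * Real.pi) =
        ∑ _q : Quotient (cyc (σ * α)), 2 * Real.pi := by
      rw [Finset.sum_const, Finset.card_univ]
    rw [h1, ← Finset.sum_sub_distrib]
    exact Finset.sum_le_sum fun q _ => hgf _
  have hC : ∑ d, ((if ω d = 0 then 2 * Real.pi else 0) + (2 * Real.pi - θ) * (n d * s d)) <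
      4 * Real.pi * Module.finrank ℝ (classFun (orbits σ α)) := by
    rw [sum_eq_sum_quotient (orbits σ α), finrank_classFun, Nat.card_eq_fintype_card,
      mul_comm (4 * Real.pi), ← nsmul_eq_mul]
    have h1 : Fintype.card (Quotient (orbits σ α)) • (4 * Real.pi) =
        ∑ _q : Quotient (orbits σ α), 4 * Real.pi := by
      rw [Finset.sum_const, Finset.card_univ]
    rw [h1]
    refine Finset.sum_lt_sum (fun q _ => (hcomp _).1)
      ⟨Quotient.mk _ d, Finset.mem_univ _, (hcomp _).2 ?_⟩
    have : orbits σ α (Quotient.mk (orbits σ α) d).out d := Quotient.mk_out (s := orbits σ α) d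
    exact (hzero _ _ this).not.2 hd
  have hE : (Fintype.card D : ℝ) = 2 * Module.finrank ℝ (classFun (cyc α)) := by
    exact_mod_cast card_eq_two_mul_finrank hα hne
  rw [Finset.sum_add_distrib, Finset.sum_const, Finset.card_univ, nsmul_eq_mul, hE] at htotal
  rw [Finset.sum_add_distrib, ← Finset.mul_sum] at hC
  have hdef' : 2 * (Module.finrank ℝ (classFun (orbits σ α)) : ℝ) +
      Module.finrank ℝ (classFun (cyc α)) ≤ Module.finrank ℝ (classFun (cyc σ)) +
      Module.finrank ℝ (classFun (cyc (σ * α))) := by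
    have : (2 * (Module.finrank ℝ (classFun (orbits σ α)) : ℤ) +
      Module.finrank ℝ (classFun (cyc α))) ≤ Module.finrank ℝ (classFun (cyc σ)) +
      Module.finrank ℝ (classFun (cyc (σ * α))) := by
      simp only [eulerDefect] at hdef
      linarith
    exact_mod_cast this
  nlinarith [mul_le_mul_of_nonneg_left hdef' Real.two_pi_pos.le]

end Rigidity

/-! ### Integral cochains, exactness of closed forms and gauge triviality on planar maps. -/

section Cohomology

open Classical

variable {D : Type*}

/-- The principal logarithm alone need not be antisymmetric at negative real values; it is used on
one chosen dart of each edge, and negated on the other. -/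
theorem exists_log {α : Equiv.Perm D} (hα : ∀ d, α (α d) = d) (hne : ∀ d, α d ≠ d) {t : D → ℂˣ}
    (ht : ∀ d, t (α d) = (t d)⁻¹) :
    ∃ ℓ : D → ℂ, (∀ d, ℓ (α d) = -ℓ d) ∧ ∀ d, Complex.exp (ℓ d) = t d := by
  let o : D → D := fun d => (Quotient.mk (cyc α) d).out
  have ho : ∀ d, o (α d) = o d := fun d => by
    simp only [o, show Quotient.mk (cyc α) (α d) = Quotient.mk (cyc α) d from
      Quotient.sound (cyc_apply α d)]
  have ho' : ∀ d, o d = d ∨ o d = α d := fun d =>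
    (cyc_involution_iff hα d (o d)).1 (Quotient.mk_out (s := cyc α) d)
  refine ⟨fun d => if o d = d then Complex.log (t d) else -Complex.log (t (α d)),
    fun d => ?_, fun d => ?_⟩
  · simp only [ho, hα]
    rcases ho' d with h | h
    · rw [if_neg (by rw [h]; exact (hne d).symm), if_pos h]
    · rw [if_pos h, if_neg (by rw [h]; exact hne d), neg_neg]
  · dsimp only
    split_ifs
    · exact Complex.exp_log (Units.ne_zero _)
    · rw [Complex.exp_neg, Complex.exp_log (Units.ne_zero _), ht]
      simp

variable [Fintype D]

/-- Two faces that are joined by a path in the dual graph differ by an integral coboundary. -/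
theorem exists_cochain {σ α : Equiv.Perm D} (hα : ∀ d, α (α d) = d)
    (htop : orbits σ α = ⊤) (a b : D) :
    ∃ n : D → ℤ, (∀ d, n (α d) = -n d) ∧ ∀ d₀, ∑ d with cyc (σ * α) d d₀, n d =
      (if cyc (σ * α) a d₀ then 1 else 0) - (if cyc (σ * α) b d₀ then 1 else 0) := by
  let r : Setoid D :=
    { r := fun a b => ∃ n : D → ℤ, (∀ d, n (α d) = -n d) ∧ ∀ d₀, ∑ d with cyc (σ * α) d d₀, n d =
        (if cyc (σ * α) a d₀ then 1 else 0) - (if cyc (σ * α) b d₀ then 1 else 0)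
      iseqv := by
        refine ⟨fun a => ⟨0, by simp, by simp⟩, ?_, ?_⟩
        · rintro a b ⟨n, h1, h2⟩
          refine ⟨-n, fun d => by simp [h1], fun d₀ => ?_⟩
          simp only [Pi.neg_apply, Finset.sum_neg_distrib, h2]
          ring
        · rintro a b c ⟨n, h1, h2⟩ ⟨m, h3, h4⟩
          refine ⟨n + m, fun d => by simp [h1, h3]; ring, fun d₀ => ?_⟩
          simp only [Pi.add_apply, Finset.sum_add_distrib, h2, h4]
          ring }
  -- Crossing one edge: the cochain is supported on the two darts of that edge.
  have hrα : ∀ d, r (α d) d := by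
    intro d
    refine ⟨fun e => (if e = α d then 1 else 0) - (if e = d then 1 else 0), fun e => ?_,
      fun d₀ => ?_⟩
    · have h1 : α e = α d ↔ e = d := α.injective.eq_iff
      have h2 : α e = d ↔ e = α d := ⟨fun h => by rw [← h, hα], fun h => by rw [h, hα]⟩
      simp only [h1, h2]
      ring
    · rw [Finset.sum_sub_distrib, Finset.sum_ite_eq', Finset.sum_ite_eq']
      simp
  have hrφ : cyc (σ * α) ≤ r := by
    intro a b hab
    refine ⟨0, by simp, fun d₀ => ?_⟩
    have : cyc (σ * α) a d₀ ↔ cyc (σ * α) b d₀ :=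
      ⟨fun h => Setoid.trans' _ (Setoid.symm' _ hab) h, fun h => Setoid.trans' _ hab h⟩
    simp [this]
  have hle : orbits σ α ≤ r := by
    refine sup_le (cyc_le_iff.2 fun d => ?_) (cyc_le_iff.2 hrα)
    have h1 : r (σ d) (α d) := hrφ (by simpa [hα] using cyc_apply (σ * α) (α d))
    exact r.trans h1 (hrα d)
  rw [htop] at hle
  exact hle (show (⊤ : Setoid D) a b from trivial)

/-- The coboundary of a function of darts along an edge reversal. -/
def edgeDiff (α : Equiv.Perm D) : (D → ℝ) →ₗ[ℝ] (D → ℝ) where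
  toFun x d := x (α d) - x d
  map_add' x y := by ext d; simp only [Pi.add_apply]; ring
  map_smul' c x := by ext d; simp only [Pi.smul_apply, smul_eq_mul, RingHom.id_apply]; ring

theorem finrank_map_edgeDiff (α : Equiv.Perm D) (U : Submodule ℝ (D → ℝ)) :
    Module.finrank ℝ (U.map (edgeDiff α)) +
      Module.finrank ℝ (U ⊓ classFun (cyc α) : Submodule ℝ (D → ℝ)) = Module.finrank ℝ U := by
  have h1 := LinearMap.finrank_range_add_finrank_ker ((edgeDiff α).domRestrict U)
  have h2 : LinearMap.ker (edgeDiff α) = classFun (cyc α) := by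
    ext x
    simp [mem_classFun_cyc, edgeDiff, funext_iff, sub_eq_zero]
  rwa [LinearMap.range_domRestrict, LinearMap.ker_domRestrict, h2,
    ← Submodule.finrank_map_subtype_eq, Submodule.map_comap_subtype] at h1

/-- On a planar map every closed 1-form is exact. -/
theorem exists_eq_edgeDiff {σ α : Equiv.Perm D} (hα : ∀ d, α (α d) = d) (hne : ∀ d, α d ≠ d)
    (hdef : eulerDefect σ α = 0) {θ : D → ℝ} (hθ : ∀ d, θ (α d) = -θ d)
    (hclosed : ∀ d₀, ∑ d with cyc (σ * α) d d₀, θ d = 0) :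
    ∃ x ∈ classFun (cyc σ), ∀ d, θ d = x (α d) - x d := by
  let B₁ := (classFun (cyc σ)).map (edgeDiff α)
  let B₂ := (classFun (cyc (σ * α))).map (edgeDiff α)
  let W := (⊤ : Submodule ℝ (D → ℝ)).map (edgeDiff α)
  have hV := finrank_map_edgeDiff α (classFun (cyc σ))
  have hF := finrank_map_edgeDiff α (classFun (cyc (σ * α)))
  have hE := finrank_map_edgeDiff α ⊤
  have hφ : classFun (cyc (σ * α)) ⊓ classFun (cyc α) = classFun (orbits σ α) := by
    ext x
    simp only [Submodule.mem_inf, mem_classFun_orbits, mem_classFun_cyc]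
    refine and_congr_left fun h => ⟨fun h1 d => ?_, fun h1 d => ?_⟩
    · have := h1 (α d)
      rwa [Equiv.Perm.mul_apply, hα, h] at this
    · rw [Equiv.Perm.mul_apply, h1, h]
  have hσ : classFun (cyc σ) ⊓ classFun (cyc α) = classFun (orbits σ α) := (classFun_sup _ _).symm
  rw [hσ] at hV
  rw [hφ] at hF
  rw [top_inf_eq, finrank_top, Module.finrank_pi, card_eq_two_mul_finrank hα hne] at hE
  -- Discrete Hodge decomposition: differentials of vertex functions are orthogonal to those of face
  -- functions.
  have horth : ∀ x ∈ classFun (cyc σ), ∀ y ∈ classFun (cyc (σ * α)),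
      ∑ d, edgeDiff α x d * edgeDiff α y d = 0 := by
    intro x hx y hy
    rw [mem_classFun_cyc] at hx hy
    have h1 : ∑ d, x (α d) * y (α d) = ∑ d, x d * y d := Equiv.sum_comp α fun d => x d * y d
    have h2 : ∑ d, x (α d) * y d = ∑ d, x d * y d := by
      rw [← Equiv.sum_comp (σ * α) fun d => x d * y d]
      exact Finset.sum_congr rfl fun d _ => by rw [hy, Equiv.Perm.mul_apply, hx]
    have h3 : ∑ d, x d * y (α d) = ∑ d, x (α d) * y d := by
      rw [← Equiv.sum_comp α fun d => x d * y (α d)]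
      simp only [hα]
    have h4 : ∀ d, edgeDiff α x d * edgeDiff α y d =
        x (α d) * y (α d) - x (α d) * y d - x d * y (α d) + x d * y d := fun d => by
      simp only [edgeDiff, LinearMap.coe_mk, AddHom.coe_mk]; ring
    rw [Finset.sum_congr rfl fun d _ => h4 d]
    simp only [Finset.sum_add_distrib, Finset.sum_sub_distrib, h1, h2, h3]
    ring
  have hzero : ∀ u : D → ℝ, ∑ d, u d * u d = 0 → u = 0 := fun u hu => by
    ext d
    have := (Finset.sum_eq_zero_iff_of_nonneg fun d _ => mul_self_nonneg (u d)).1 hu d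
      (Finset.mem_univ d)
    exact mul_self_eq_zero.1 this
  have hdisj : B₁ ⊓ B₂ = ⊥ := by
    rw [eq_bot_iff]
    rintro u ⟨⟨x, hx, rfl⟩, ⟨y, hy, hxy⟩⟩
    refine hzero _ ?_
    conv_lhs => enter [2, d]; rw [show edgeDiff α x d * edgeDiff α x d =
      edgeDiff α x d * edgeDiff α y d by rw [hxy]]
    exact horth x hx y hy
  -- The dimensions `V - C` and `F - C` add up to `E` exactly because the genus is zero; there are
  -- no harmonic forms.
  have hsum : B₁ ⊔ B₂ = W := by
    refine Submodule.eq_of_le_of_finrank_le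
      (sup_le (Submodule.map_mono le_top) (Submodule.map_mono le_top)) ?_
    have h1 := Submodule.finrank_sup_add_finrank_inf_eq B₁ B₂
    rw [hdisj, finrank_bot] at h1
    simp only [eulerDefect] at hdef
    simp only [B₁, B₂, W] at h1 ⊢
    omega
  have hθW : θ ∈ W := ⟨fun d => -θ d / 2, trivial, by
    ext d
    simp only [edgeDiff, LinearMap.coe_mk, AddHom.coe_mk, hθ]
    ring⟩
  rw [← hsum] at hθW
  obtain ⟨_, ⟨x, hx, rfl⟩, _, ⟨y, hy, rfl⟩, hxy⟩ := Submodule.mem_sup.1 hθW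
  have h1 : ∑ d, θ d * y d = 0 := by
    rw [sum_eq_sum_quotient (cyc (σ * α))]
    refine Finset.sum_eq_zero fun q _ => ?_
    rw [Finset.sum_congr rfl fun d hd => ?_, ← Finset.sum_mul, hclosed q.out, zero_mul]
    · exact y q.out
    · simp only [Finset.mem_filter, Finset.mem_univ, true_and] at hd
      rw [mem_classFun.1 hy _ _ hd]
  have h2 : ∑ d, θ d * edgeDiff α y d = 0 := by
    have h3 : ∑ d, θ d * y (α d) = -∑ d, θ d * y d := by
      rw [← Equiv.sum_comp α fun d => θ d * y (α d), ← Finset.sum_neg_distrib]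
      exact Finset.sum_congr rfl fun d _ => by rw [hα, hθ]; ring
    simp only [edgeDiff, LinearMap.coe_mk, AddHom.coe_mk, mul_sub, Finset.sum_sub_distrib, h3, h1]
    ring
  have h3 : edgeDiff α y = 0 := by
    refine hzero _ ?_
    have h4 : ∀ d, edgeDiff α y d * edgeDiff α y d =
        θ d * edgeDiff α y d - edgeDiff α x d * edgeDiff α y d := fun d => by
      rw [← hxy, Pi.add_apply]; ring
    rw [Finset.sum_congr rfl fun d _ => h4 d, Finset.sum_sub_distrib, h2, horth x hx y hy, sub_zero]
  exact ⟨x, hx, fun d => by rw [← hxy, h3, add_zero]; rfl⟩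

theorem exists_eq_sub_of_closed {σ α : Equiv.Perm D} (hα : ∀ d, α (α d) = d) (hne : ∀ d, α d ≠ d)
    (hdef : eulerDefect σ α = 0) {θ : D → ℂ} (hθ : ∀ d, θ (α d) = -θ d)
    (hclosed : ∀ d₀, ∑ d with cyc (σ * α) d d₀, θ d = 0) :
    ∃ x : D → ℂ, (∀ d e, cyc σ d e → x d = x e) ∧ ∀ d, θ d = x (α d) - x d := by
  obtain ⟨x, hx, hx'⟩ := exists_eq_edgeDiff hα hne hdef (θ := fun d => (θ d).re)
    (fun d => by simp [hθ]) (fun d₀ => by rw [← Complex.re_sum, hclosed]; rfl)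
  obtain ⟨y, hy, hy'⟩ := exists_eq_edgeDiff hα hne hdef (θ := fun d => (θ d).im)
    (fun d => by simp [hθ]) (fun d₀ => by rw [← Complex.im_sum, hclosed]; rfl)
  refine ⟨fun d => ⟨x d, y d⟩, fun d e h => ?_, fun d => ?_⟩
  · simp only [mem_classFun.1 hx _ _ h, mem_classFun.1 hy _ _ h]
  · exact Complex.ext (hx' d) (hy' d)

/-- Superpose cochains running from each face to one base face, with multiplicities `m`. Their
contributions at the base face cancel because `m` sums to zero. -/
theorem exists_integral_cochain {σ α : Equiv.Perm D} (hα : ∀ d, α (α d) = d)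
    (htop : orbits σ α = ⊤) (m : Quotient (cyc (σ * α)) → ℤ) (hm : ∑ q, m q = 0) :
    ∃ k : D → ℤ, (∀ d, k (α d) = -k d) ∧
      ∀ d₀, ∑ d with cyc (σ * α) d d₀, k d = m (Quotient.mk _ d₀) := by
  rcases isEmpty_or_nonempty D with hD | ⟨⟨b⟩⟩
  · exact ⟨0, fun d => hD.elim d, fun d => hD.elim d⟩
  choose n hn1 hn2 using fun q : Quotient (cyc (σ * α)) => exists_cochain hα htop q.out b
  refine ⟨fun d => ∑ q, m q * n q d, fun d => ?_, fun d₀ => ?_⟩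
  · simp only [hn1, mul_neg, Finset.sum_neg_distrib]
  · rw [Finset.sum_comm]
    simp only [← Finset.mul_sum, hn2, mul_sub, Finset.sum_sub_distrib]
    rw [← Finset.sum_mul, hm, zero_mul, sub_zero]
    rw [Finset.sum_eq_single (Quotient.mk _ d₀)]
    · rw [if_pos (Quotient.mk_out (s := cyc (σ * α)) d₀), mul_one]
    · intro q _ hq
      rw [if_neg, mul_zero]
      intro h
      refine hq ?_
      rw [← Quotient.out_eq q]
      exact Quotient.sound h
    · simp

/-- On a connected planar map a connection without curvature is a pure gauge. -/
theorem exists_gauge {σ α : Equiv.Perm D} (hα : ∀ d, α (α d) = d) (hne : ∀ d, α d ≠ d)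
    (hdef : eulerDefect σ α = 0) (htop : orbits σ α = ⊤) {t : D → ℂˣ}
    (ht : ∀ d, t (α d) = (t d)⁻¹) (hflat : ∀ d₀, ∏ d with cyc (σ * α) d d₀, t d = 1) :
    ∃ g : D → ℂˣ, (∀ d e, cyc σ d e → g d = g e) ∧ ∀ d, t d = g (α d) * (g d)⁻¹ := by
  obtain ⟨ℓ, hℓ, hℓt⟩ := exists_log hα hne ht
  have hint : ∀ d₀, ∃ m : ℤ, ∑ d with cyc (σ * α) d d₀, ℓ d = m * (2 * Real.pi * Complex.I) := by
    intro d₀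
    rw [← Complex.exp_eq_one_iff, Complex.exp_sum]
    simp only [hℓt]
    rw [← Units.coe_prod, hflat]
    rfl
  choose m hm using hint
  have h2πi : (2 * Real.pi * Complex.I : ℂ) ≠ 0 := Complex.two_pi_I_ne_zero
  -- The logarithms sum to `2πi m` around the faces. An integral cochain with the same face sums
  -- corrects the branches and makes the form closed; its potential exponentiates to the gauge.
  obtain ⟨k, hk1, hk2⟩ := exists_integral_cochain hα htop (fun q => m q.out) (by
    have h1 : ∑ d, ℓ d = 0 := by
      have := Equiv.sum_comp α ℓ
      simp only [hℓ, Finset.sum_neg_distrib] at this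
      exact self_eq_neg.1 this.symm
    rw [sum_eq_sum_quotient (cyc (σ * α))] at h1
    simp only [hm] at h1
    rw [← Finset.sum_mul, mul_eq_zero, or_iff_left h2πi] at h1
    exact_mod_cast h1)
  obtain ⟨x, hx1, hx2⟩ := exists_eq_sub_of_closed hα hne hdef
    (θ := fun d => ℓ d - k d * (2 * Real.pi * Complex.I))
    (fun d => by simp only [hℓ, hk1]; push_cast; ring) (fun d₀ => by
      have hq : cyc (σ * α) (Quotient.mk (cyc (σ * α)) d₀).out d₀ :=
        Quotient.mk_out (s := cyc (σ * α)) d₀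
      have h1 : ∑ d with cyc (σ * α) d d₀, ℓ d =
          ∑ d with cyc (σ * α) d (Quotient.mk (cyc (σ * α)) d₀).out, ℓ d :=
        Finset.sum_congr (Finset.filter_congr fun d _ =>
          ⟨fun h => Setoid.trans' _ h (Setoid.symm' _ hq), fun h => Setoid.trans' _ h hq⟩)
          fun _ _ => rfl
      rw [Finset.sum_sub_distrib, h1, hm, ← Finset.sum_mul, ← Int.cast_sum, hk2, sub_self])
  refine ⟨fun d => Units.mk0 (Complex.exp (x d)) (Complex.exp_ne_zero _), fun d e h => ?_,
    fun d => ?_⟩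
  · simp only [hx1 d e h]
  · ext
    simp only [Units.val_mul, Units.val_mk0, Units.val_inv_eq_inv_val]
    rw [← Complex.exp_neg, ← Complex.exp_add, ← sub_eq_add_neg, ← hx2, Complex.exp_sub, hℓt,
      Complex.exp_int_mul_two_pi_mul_I, div_one]

end Cohomology

/-! ### Translation of annular graphs into permutations. -/

section Graph

variable {V D : Type*}

theorem EmbeddedGraph.faceOf_eq_iff (G : EmbeddedGraph V D) {d e : D} :
    G.faceOf d = G.faceOf e ↔ cyc (G.rot * G.rev) d e :=
  Quotient.eq (r := cyc (G.rot * G.rev))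

theorem EmbeddedGraph.exists_faceOf_eq (G : EmbeddedGraph V D) (F : G.Face) :
    ∃ d, G.faceOf d = F :=
  Quotient.exists_rep (s := cyc (G.rot * G.rev)) F

theorem EmbeddedGraph.tail_rot (G : EmbeddedGraph V D) (d : D) : G.tail (G.rot d) = G.tail d :=
  (G.tail_eq_iff _ _).2 (cyc_apply G.rot d)

theorem AnnularGraph.tail_surjective (G : AnnularGraph V D) : Function.Surjective G.tail := by
  intro v
  obtain ⟨d₀, -⟩ := G.exists_faceOf_eq G.inner
  rcases (G.connected (G.tail d₀) v).cases_tail with h | ⟨_, _, e, _, he⟩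
  · exact ⟨d₀, h.symm⟩
  · exact ⟨G.rev e, he⟩

theorem AnnularGraph.orbits_eq_top (G : AnnularGraph V D) : orbits G.rot G.rev = ⊤ := by
  rw [eq_top_iff]
  intro a b _
  refine rel_of_forall_classFun fun x hx => ?_
  rw [classFun_sup] at hx
  have h1 : ∀ a b, G.tail a = G.tail b → x a = x b := fun a b h =>
    mem_classFun.1 hx.1 _ _ ((G.tail_eq_iff a b).1 h)
  have h2 := G.connected (G.tail a) (G.tail b)
  generalize hw : G.tail b = w at h2
  induction h2 generalizing b with
  | refl => exact h1 _ _ hw.symm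
  | tail _ h ih =>
    obtain ⟨e, he1, he2⟩ := h
    rw [ih trivial he1, ← mem_classFun_cyc.1 hx.2 e]
    exact h1 _ _ (he2.trans hw.symm)

theorem AnnularGraph.eulerDefect_eq_zero [Fintype D] (G : AnnularGraph V D) :
    eulerDefect G.rot G.rev = 0 := by
  have hV : Nat.card (Quotient (cyc G.rot)) = Nat.card V := by
    refine Nat.card_congr (Equiv.ofBijective
      (Quotient.lift G.tail fun a b h => (G.tail_eq_iff a b).2 h) ⟨?_, ?_⟩)
    · intro p q
      induction p, q using Quotient.inductionOn₂ with
      | h a b => exact fun h => Quotient.sound ((G.tail_eq_iff a b).1 h)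
    · intro v
      obtain ⟨d, rfl⟩ := G.tail_surjective v
      exact ⟨Quotient.mk _ d, rfl⟩
  have hC : Nat.card (Quotient (⊤ : Setoid D)) = 1 := by
    obtain ⟨d₀, -⟩ := G.exists_faceOf_eq G.inner
    rw [Nat.card_eq_one_iff_unique]
    refine ⟨⟨fun p q => ?_⟩, ⟨Quotient.mk _ d₀⟩⟩
    induction p, q using Quotient.inductionOn₂ with
    | h a b => exact Quotient.sound trivial
  have := G.euler
  rw [eulerDefect, G.orbits_eq_top]
  simp only [finrank_classFun, hV, hC]
  change (Nat.card V : ℤ) - Nat.card (Quotient (cyc G.rev)) +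
    Nat.card (Quotient (cyc (G.rot * G.rev))) = 2 at this
  omega

end Graph

/-! ### Existence of flat connections and their uniqueness up to gauge. -/

section Gauge

open Classical

variable {V D : Type*} [Fintype D]

theorem EmbeddedGraph.Connection.monodromy_faceOf {G : EmbeddedGraph V D} (Φ : G.Connection)
    (d₀ : D) : Φ.monodromy (G.faceOf d₀) = ∏ d with cyc (G.rot * G.rev) d d₀, Φ.transport d := by
  rw [monodromy]
  refine Finset.prod_congr (Finset.filter_congr fun d _ => ?_) fun _ _ => rfl
  exact G.faceOf_eq_iff

theorem prod_eq_prod_quotient {M : Type*} [CommMonoid M] (r : Setoid D) (g : D → M) :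
    ∏ d, g d = ∏ q : Quotient r, ∏ d with r d q.out, g d :=
  sum_eq_sum_quotient (M := Additive M) r g

theorem prod_class_eq_one {r : Setoid D} {t : D → ℂˣ} (ht : ∏ d, t d = 1) {d₀ : D}
    (h : ∀ d, ¬ r d d₀ → ∏ e with r e d, t e = 1) : ∏ e with r e d₀, t e = 1 := by
  rw [prod_eq_prod_quotient r, Finset.prod_eq_single (Quotient.mk r d₀)] at ht
  · rw [← ht]
    have hq : r (Quotient.mk r d₀).out d₀ := Quotient.mk_out d₀
    exact Finset.prod_congr (Finset.filter_congr fun d _ =>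
      ⟨fun h => r.trans h (r.symm hq), fun h => r.trans h hq⟩) fun _ _ => rfl
  · intro q _ hq
    refine h _ fun h' => hq ?_
    rw [← Quotient.out_eq q]
    exact Quotient.sound h'
  · simp

theorem prod_antisymm_eq_one {α : Equiv.Perm D} (hα : ∀ d, α (α d) = d) (hne : ∀ d, α d ≠ d)
    {t : D → ℂˣ} (ht : ∀ d, t (α d) = (t d)⁻¹) : ∏ d, t d = 1 :=
  Finset.prod_involution (fun d _ => α d) (fun d _ => by rw [ht, mul_inv_cancel])
    (fun d _ _ => hne d) (fun _ _ => Finset.mem_univ _) (fun d _ => hα d)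

theorem AnnularGraph.exists_gauge_of_flat (G : AnnularGraph V D) {z : ℂˣ}
    {Φ Ψ : G.toEmbeddedGraph.Connection} (hΦ : G.IsFlatWithMonodromy Φ z)
    (hΨ : G.IsFlatWithMonodromy Ψ z) :
    ∃ g : V → ℂˣ, ∀ d, Φ.transport d = Ψ.transport d * (g (G.head d) * (g (G.tail d))⁻¹) := by
  let t : D → ℂˣ := fun d => Φ.transport d * (Ψ.transport d)⁻¹
  have ht : ∀ d, t (G.rev d) = (t d)⁻¹ := fun d => by
    simp only [t, Φ.transport_rev, Ψ.transport_rev, mul_inv]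
  have hface : ∀ d₀, G.faceOf d₀ ≠ G.outer → ∏ d with cyc (G.rot * G.rev) d d₀, t d = 1 := by
    intro d₀ hd
    rw [Finset.prod_mul_distrib, Finset.prod_inv_distrib, ← Φ.monodromy_faceOf,
      ← Ψ.monodromy_faceOf]
    by_cases h : G.faceOf d₀ = G.inner
    · rw [h, hΦ.2, hΨ.2, mul_inv_cancel]
    · rw [hΦ.1 _ h hd, hΨ.1 _ h hd, mul_inv_cancel]
  obtain ⟨g, hg1, hg2⟩ := exists_gauge G.rev_rev G.rev_ne G.eulerDefect_eq_zero G.orbits_eq_top ht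
    fun d₀ => by
      by_cases hd : G.faceOf d₀ = G.outer
      -- Flatness prescribes nothing at the outer face. Its monodromy is determined by the others,
      -- since the product of the transports over all darts is one.
      · refine prod_class_eq_one (prod_antisymm_eq_one G.rev_rev G.rev_ne ht) fun d hdd => ?_
        refine hface d fun h => hdd ?_
        rw [← G.faceOf_eq_iff, h, hd]
      · exact hface d₀ hd
  let s := Function.surjInv G.tail_surjective
  have hs : ∀ d, g (s (G.tail d)) = g d := fun d =>
    hg1 _ _ ((G.tail_eq_iff _ _).1 (Function.surjInv_eq G.tail_surjective _))
  refine ⟨fun v => g (s v), fun d => ?_⟩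
  simp only [EmbeddedGraph.head, hs, ← hg2, t]
  rw [mul_comm (Φ.transport d), mul_inv_cancel_left]

theorem AnnularGraph.det_laplacian_eq [Fintype V] (G : AnnularGraph V D)
    (c : G.toEmbeddedGraph.Conductance) {z : ℂˣ}
    {Φ Ψ : G.toEmbeddedGraph.Connection} (hΦ : G.IsFlatWithMonodromy Φ z)
    (hΨ : G.IsFlatWithMonodromy Ψ z) :
    LinearMap.det (EmbeddedGraph.laplacian c Φ) = LinearMap.det (EmbeddedGraph.laplacian c Ψ) := by
  obtain ⟨g, hg⟩ := G.exists_gauge_of_flat hΦ hΨ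
  let mul : (V → ℂˣ) → (V → ℂ) →ₗ[ℂ] (V → ℂ) := fun h =>
    { toFun := fun f v => h v * f v
      map_add' := fun f₁ f₂ => by ext v; simp only [Pi.add_apply]; ring
      map_smul' := fun a f => by
        ext v; simp only [Pi.smul_apply, smul_eq_mul, RingHom.id_apply]; ring }
  have h1 : EmbeddedGraph.laplacian c Φ ∘ₗ mul g = mul g ∘ₗ EmbeddedGraph.laplacian c Ψ := by
    refine LinearMap.ext fun f => funext fun v => ?_
    simp only [LinearMap.comp_apply, mul, LinearMap.coe_mk, AddHom.coe_mk,
      EmbeddedGraph.laplacian, Finset.mul_sum]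
    refine Finset.sum_congr rfl fun d hd => ?_
    simp only [Finset.mem_filter, Finset.mem_univ, true_and] at hd
    rw [Φ.transport_rev, Ψ.transport_rev, hg, hd]
    have h2 := Units.ne_zero (Ψ.transport d)
    have h3 := Units.ne_zero (g v)
    have h4 := Units.ne_zero (g (G.head d))
    simp only [mul_inv, inv_inv, Units.val_mul, Units.val_inv_eq_inv_val]
    field_simp
  have h2 : mul g ∘ₗ mul g⁻¹ = LinearMap.id := by
    refine LinearMap.ext fun f => funext fun v => ?_
    simp [mul]
  have h3 : LinearMap.det (mul g) ≠ 0 := by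
    intro h
    have := congrArg LinearMap.det h2
    rw [LinearMap.det_comp, h, zero_mul, LinearMap.det_id] at this
    exact zero_ne_one this
  have h4 := congrArg LinearMap.det h1
  rw [LinearMap.det_comp, LinearMap.det_comp, mul_comm] at h4
  exact mul_left_cancel₀ h3 h4

/-- The connection whose parallel transports are the powers of `z` given by an integral
cochain. -/
def EmbeddedGraph.powConnection (G : EmbeddedGraph V D) (n : D → ℤ) (hn : ∀ d, n (G.rev d) = -n d)
    (z : ℂˣ) : G.Connection where
  transport d := z ^ n d
  transport_rev d := by rw [hn, zpow_neg]

theorem AnnularGraph.isFlat_powConnection (G : AnnularGraph V D) {n : D → ℤ}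
    (hn : ∀ d, n (G.rev d) = -n d) {a b : D} (ha : G.faceOf a = G.inner)
    (hb : G.faceOf b = G.outer) (hsum : ∀ d₀, ∑ d with cyc (G.rot * G.rev) d d₀, n d =
      (if cyc (G.rot * G.rev) a d₀ then 1 else 0) - (if cyc (G.rot * G.rev) b d₀ then 1 else 0))
    (z : ℂˣ) : G.IsFlatWithMonodromy (G.powConnection n hn z) z := by
  simp only [← G.faceOf_eq_iff, ha, hb] at hsum
  have h : ∀ d₀, (G.powConnection n hn z).monodromy (G.faceOf d₀) =
      z ^ ((if G.inner = G.faceOf d₀ then 1 else 0) -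
        (if G.outer = G.faceOf d₀ then 1 else 0) : ℤ) := by
    intro d₀
    rw [EmbeddedGraph.Connection.monodromy_faceOf, ← hsum]
    simp only [EmbeddedGraph.powConnection, ← G.faceOf_eq_iff]
    exact prod_zpow_eq_zpow_sum _ _ _
  refine ⟨fun F hF1 hF2 => ?_, ?_⟩
  · obtain ⟨d, rfl⟩ := G.exists_faceOf_eq F
    rw [h, if_neg hF1.symm, if_neg hF2.symm]
    simp
  · rw [← ha, h, ha, if_pos rfl, if_neg G.inner_ne_outer.symm]
    simp

end Gauge

/-! ### The Laplacian over Laurent polynomials, reciprocity and the double factor. -/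

section LaurentLaplacian

open Classical

variable {V D : Type*} [Fintype V] [Fintype D] {G : EmbeddedGraph V D}

/-- The matrix of the Laplacian of `G.powConnection n z`, with `z` as an indeterminate. -/
noncomputable def laurentLaplacian (c : G.Conductance) (n : D → ℤ) : Matrix V V ℂ[T;T⁻¹] :=
  Matrix.of fun v w => ∑ d with G.tail d = v, LaurentPolynomial.C (c.weight d : ℂ) *
    ((if v = w then 1 else 0) - if G.head d = w then LaurentPolynomial.T (n (G.rev d)) else 0)

theorem laurentEval_eq (z : ℂˣ) (P : ℂ[T;T⁻¹]) :
    laurentEval z P = LaurentPolynomial.eval₂ (RingHom.id ℂ) z P := rfl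

theorem toMatrix'_laplacian (c : G.Conductance) {n : D → ℤ} (hn : ∀ d, n (G.rev d) = -n d)
    (z : ℂˣ) : LinearMap.toMatrix' (EmbeddedGraph.laplacian c (G.powConnection n hn z)) =
      (laurentLaplacian c n).map (LaurentPolynomial.eval₂ (RingHom.id ℂ) z) := by
  ext v w
  rw [LinearMap.toMatrix'_apply, Matrix.map_apply, laurentLaplacian, Matrix.of_apply, map_sum]
  simp only [EmbeddedGraph.laplacian, LinearMap.coe_mk, AddHom.coe_mk]
  refine Finset.sum_congr rfl fun d _ => ?_
  rw [map_mul, map_sub, LaurentPolynomial.eval₂_C, apply_ite (LaurentPolynomial.eval₂ _ z),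
    apply_ite (LaurentPolynomial.eval₂ _ z), map_one, map_zero, LaurentPolynomial.eval₂_T]
  simp only [EmbeddedGraph.powConnection, Pi.single_apply, RingHom.id_apply, mul_ite, mul_one,
    mul_zero]

theorem det_laplacian_eq_laurentEval (c : G.Conductance) {n : D → ℤ}
    (hn : ∀ d, n (G.rev d) = -n d) (z : ℂˣ) :
    LinearMap.det (EmbeddedGraph.laplacian c (G.powConnection n hn z)) =
      laurentEval z (laurentLaplacian c n).det := by
  rw [← LinearMap.det_toMatrix', toMatrix'_laplacian, laurentEval_eq, RingHom.map_det]
  rfl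

/-- Reversing every dart swaps rows with columns and changes the sign of `n`, so inverting the
variable transposes the matrix. -/
theorem invert_det_laurentLaplacian (c : G.Conductance) {n : D → ℤ}
    (hn : ∀ d, n (G.rev d) = -n d) :
    LaurentPolynomial.invert (laurentLaplacian c n).det = (laurentLaplacian c n).det := by
  have h : (laurentLaplacian c n).map (LaurentPolynomial.invert (R := ℂ)) =
      (laurentLaplacian c n).transpose := by
    ext1 v w
    simp only [Matrix.map_apply, Matrix.transpose_apply, laurentLaplacian, Matrix.of_apply,
      map_sum, map_mul, map_sub, LaurentPolynomial.invert_C, apply_ite LaurentPolynomial.invert,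
      map_one, map_zero, LaurentPolynomial.invert_T, mul_sub, Finset.sum_sub_distrib]
    congr 1
    · by_cases hvw : v = w
      · rw [hvw]
      · simp [hvw, Ne.symm hvw]
    · simp only [Finset.sum_filter]
      rw [← Equiv.sum_comp G.rev]
      refine Finset.sum_congr rfl fun d _ => ?_
      have h1 : G.tail (G.rev d) = G.head d := rfl
      have h2 : G.head (G.rev d) = G.tail d := by rw [EmbeddedGraph.head, G.rev_rev]
      rw [h1, h2, G.rev_rev, c.weight_rev, hn]
      split_ifs <;> simp
  have h1 := AlgHom.map_det (LaurentPolynomial.invert (R := ℂ)).toAlgHom (laurentLaplacian c n)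
  refine h1.trans ?_
  rw [← Matrix.det_transpose (laurentLaplacian c n), ← h]
  rfl

theorem sub_one_dvd_of_laurentEval_one {P : ℂ[T;T⁻¹]} (h : laurentEval 1 P = 0) :
    ∃ R, P = (LaurentPolynomial.T 1 - 1) * R := by
  obtain ⟨k, p, hp⟩ := LaurentPolynomial.exists_T_pow P
  have h1 : p.eval 1 = 0 := by
    have := congrArg (laurentEval 1) hp
    rw [laurentEval_eq, laurentEval_eq, map_mul, ← laurentEval_eq 1 P, h, zero_mul,
      LaurentPolynomial.eval₂_toLaurent] at this
    simpa [Polynomial.eval₂_eq_eval_map] using this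
  obtain ⟨q, rfl⟩ := Polynomial.dvd_iff_isRoot.2 h1
  refine ⟨Polynomial.toLaurent q * LaurentPolynomial.T (-k), ?_⟩
  rw [map_mul, map_sub, Polynomial.toLaurent_X, Polynomial.toLaurent_C, map_one] at hp
  rw [← mul_assoc, hp, LaurentPolynomial.mul_T_assoc]
  simp

theorem laurentEval_one_invert (P : ℂ[T;T⁻¹]) :
    laurentEval 1 (LaurentPolynomial.invert P) = laurentEval 1 P := by
  rw [laurentEval_eq, laurentEval_eq]
  induction P using LaurentPolynomial.induction_on' with
  | add p q hp hq => rw [map_add, map_add, hp, hq, map_add]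
  | C_mul_T n a => simp

/-- A root of a reciprocal Laurent polynomial at `1` is at least double. -/
theorem sub_one_sq_dvd_of_reciprocal {P : ℂ[T;T⁻¹]} (hP : LaurentPolynomial.invert P = P)
    (h : laurentEval 1 P = 0) : ∃ R, P = (LaurentPolynomial.T 1 - 1) ^ 2 * R := by
  obtain ⟨R, hR⟩ := sub_one_dvd_of_laurentEval_one h
  have hT : (LaurentPolynomial.T 1 * LaurentPolynomial.T (-1) : ℂ[T;T⁻¹]) = 1 := by
    rw [← LaurentPolynomial.T_add]; simp
  have hne : (LaurentPolynomial.T 1 - 1 : ℂ[T;T⁻¹]) ≠ 0 := by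
    intro h0
    have := congrArg (laurentEval (Units.mk0 2 two_ne_zero)) h0
    rw [laurentEval_eq, laurentEval_eq, map_sub, map_one, map_zero,
      LaurentPolynomial.eval₂_T] at this
    norm_num at this
  -- Reciprocity of `P` makes its cofactor antireciprocal up to a monomial, so evaluation at `1`
  -- yields `R(1) = -R(1)`.
  have h1 : R = -(LaurentPolynomial.T (-1) * LaurentPolynomial.invert R) := by
    refine mul_left_cancel₀ hne ?_
    rw [← hR]
    conv_lhs => rw [← hP, hR]
    rw [map_mul, map_sub, LaurentPolynomial.invert_T, map_one]
    linear_combination LaurentPolynomial.invert R * hT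
  have h2 : laurentEval 1 R = 0 := by
    have h3 := congrArg (laurentEval 1) h1
    rw [laurentEval_eq 1 (-_), map_neg, map_mul, ← laurentEval_eq 1 (LaurentPolynomial.invert R),
      laurentEval_one_invert, LaurentPolynomial.eval₂_T] at h3
    simp only [one_zpow, Units.val_one, one_mul] at h3
    exact self_eq_neg.1 h3
  obtain ⟨R', hR'⟩ := sub_one_dvd_of_laurentEval_one h2
  exact ⟨R', by rw [hR, hR']; ring⟩

end LaurentLaplacian

/-! ### Covariant derivative and Dirichlet energy. -/

section CovariantDerivative

variable {V D : Type*} {G : EmbeddedGraph V D}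

/-- The covariant derivative of a section along a dart, as an element of the fibre over the
tail of the dart. -/
def EmbeddedGraph.Connection.covDeriv (Φ : G.Connection) (f : V → ℂ) (d : D) : ℂ :=
  f (G.tail d) - Φ.transport (G.rev d) * f (G.head d)

theorem EmbeddedGraph.head_rev (G : EmbeddedGraph V D) (d : D) : G.head (G.rev d) = G.tail d := by
  rw [EmbeddedGraph.head, G.rev_rev]

theorem EmbeddedGraph.Connection.covDeriv_rev (Φ : G.Connection) (f : V → ℂ) (d : D) :
    Φ.covDeriv f (G.rev d) = -Φ.transport d * Φ.covDeriv f d := by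
  have h := Units.ne_zero (Φ.transport d)
  rw [covDeriv, covDeriv, G.head_rev, G.rev_rev, Φ.transport_rev, Units.val_inv_eq_inv_val]
  change f (G.head d) - _ = _
  field_simp
  ring

theorem EmbeddedGraph.Connected.eq_zero_of_covDeriv_eq_zero (hG : G.Connected) {Φ : G.Connection}
    {f : V → ℂ} (hf : ∀ d, Φ.covDeriv f d = 0) {v : V} (hv : f v = 0) : f = 0 := by
  ext w
  induction hG v w with
  | refl => exact hv
  | tail _ h ih =>
    obtain ⟨d, rfl, rfl⟩ := h
    have := hf d
    rw [EmbeddedGraph.Connection.covDeriv, ih, Pi.zero_apply, zero_sub, neg_eq_zero, mul_eq_zero,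
      or_iff_right (Units.ne_zero _)] at this
    exact this

/-- The sum of the covariant derivatives along a path, transported to its starting point. -/
theorem sum_covDeriv_path {ψ : D → D} {t : D → ℂˣ} {x ω : D → ℂ}
    (hω : ∀ d, ω d = x d - ((t d)⁻¹ : ℂˣ) * x (ψ d)) (d₀ : D) (m : ℕ) :
    ∑ k ∈ Finset.range m, ((∏ j ∈ Finset.range k, t (ψ^[j] d₀) : ℂˣ)⁻¹ : ℂˣ) * ω (ψ^[k] d₀) =
      x d₀ - ((∏ j ∈ Finset.range m, t (ψ^[j] d₀) : ℂˣ)⁻¹ : ℂˣ) * x (ψ^[m] d₀) := by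
  induction m with
  | zero => simp
  | succ m ih =>
    rw [Finset.sum_range_succ, ih, hω, Finset.prod_range_succ, Function.iterate_succ_apply',
      mul_inv, Units.val_mul]
    ring

variable [Fintype D]

open Classical in
theorem EmbeddedGraph.Connection.laplacian_apply (c : G.Conductance) (Φ : G.Connection)
    (f : V → ℂ) (v : V) : EmbeddedGraph.laplacian c Φ f v =
      ∑ d with G.tail d = v, (c.weight d : ℂ) * Φ.covDeriv f d := by
  simp only [EmbeddedGraph.laplacian, LinearMap.coe_mk, AddHom.coe_mk, covDeriv]
  refine Finset.sum_congr rfl fun d hd => ?_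
  simp only [Finset.mem_filter, Finset.mem_univ, true_and] at hd
  rw [hd]

/-- Summation by parts: unitarity makes the terms of a dart and its reverse combine to a square. The
factor `2` appears because the right side counts every edge twice. -/
theorem EmbeddedGraph.Connection.dirichlet_energy [Fintype V] (c : G.Conductance)
    {Φ : G.Connection} (hΦ : ∀ d, ‖(Φ.transport d : ℂ)‖ = 1) (f : V → ℂ) :
    2 * ∑ v, starRingEnd ℂ (f v) * EmbeddedGraph.laplacian c Φ f v =
      ((∑ d, c.weight d * ‖Φ.covDeriv f d‖ ^ 2 : ℝ) : ℂ) := by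
  classical
  let A : D → ℂ := fun d => starRingEnd ℂ (f (G.tail d)) * (c.weight d * Φ.covDeriv f d)
  have h1 : ∑ v, starRingEnd ℂ (f v) * EmbeddedGraph.laplacian c Φ f v = ∑ d, A d := by
    rw [← Finset.sum_fiberwise Finset.univ G.tail A]
    refine Finset.sum_congr rfl fun v _ => ?_
    rw [Φ.laplacian_apply, Finset.mul_sum]
    refine Finset.sum_congr rfl fun d hd => ?_
    simp only [Finset.mem_filter, Finset.mem_univ, true_and] at hd
    simp only [A, hd]
  have h2 : ∀ d, A d + A (G.rev d) = ((c.weight d * ‖Φ.covDeriv f d‖ ^ 2 : ℝ) : ℂ) := by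
    intro d
    have ht : starRingEnd ℂ (Φ.transport d : ℂ) = (Φ.transport d : ℂ)⁻¹ :=
      (Complex.inv_eq_conj (hΦ d)).symm
    have ht' := Units.ne_zero (Φ.transport d)
    simp only [A]
    rw [Φ.covDeriv_rev, c.weight_rev]
    push_cast
    rw [← Complex.conj_mul', EmbeddedGraph.Connection.covDeriv, Φ.transport_rev]
    change _ + starRingEnd ℂ (f (G.head d)) * _ = _
    rw [map_sub, map_mul, Units.val_inv_eq_inv_val, map_inv₀, ht, inv_inv]
    ring
  rw [h1, two_mul]
  nth_rw 2 [← Equiv.sum_comp G.rev A]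
  rw [← Finset.sum_add_distrib, Finset.sum_congr rfl fun d _ => h2 d]
  push_cast
  rfl

end CovariantDerivative

/-! ### The root at `1` has multiplicity at most two. -/

section DoubleRoot

open Classical

variable {V D : Type*}

theorem EmbeddedGraph.norm_transport_powConnection {G : EmbeddedGraph V D} {n : D → ℤ}
    (hn : ∀ d, n (G.rev d) = -n d) {z : ℂˣ} (hz : ‖(z : ℂ)‖ = 1) (d : D) :
    ‖((G.powConnection n hn z).transport d : ℂ)‖ = 1 := by
  simp [EmbeddedGraph.powConnection, hz]

variable [Fintype D]

/-- The transported derivatives telescope along the boundary walk, so only the holonomy defect at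
the starting vertex remains. -/
theorem EmbeddedGraph.Connection.covDeriv_faceWalk {G : EmbeddedGraph V D} (Φ : G.Connection)
    (f : V → ℂ) (d₀ : D) :
    ∑ k ∈ Finset.range (Function.minimalPeriod (G.rot * G.rev) d₀),
      ((∏ j ∈ Finset.range k, Φ.transport ((G.rot * G.rev)^[j] d₀) : ℂˣ)⁻¹ : ℂˣ) *
        Φ.covDeriv f ((G.rot * G.rev)^[k] d₀) =
      (1 - ((Φ.monodromy (G.faceOf d₀))⁻¹ : ℂˣ)) * f (G.tail d₀) := by
  rw [sum_covDeriv_path (x := fun d => f (G.tail d)), Function.iterate_minimalPeriod,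
    Φ.monodromy_faceOf, prod_cycle_eq_prod_range (G.rot * G.rev) d₀ Φ.transport]
  · ring
  · intro d
    rw [EmbeddedGraph.Connection.covDeriv, Φ.transport_rev, Equiv.Perm.mul_apply, G.tail_rot]
    rfl

theorem EmbeddedGraph.Connection.norm_mul_le_sum_covDeriv {G : EmbeddedGraph V D}
    {Φ : G.Connection} (hΦ : ∀ d, ‖(Φ.transport d : ℂ)‖ = 1) (f : V → ℂ) (d₀ : D) :
    ‖(Φ.monodromy (G.faceOf d₀) : ℂ) - 1‖ * ‖f (G.tail d₀)‖ ≤ ∑ d, ‖Φ.covDeriv f d‖ := by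
  have hprod : ∀ s : Finset D, ‖((∏ d ∈ s, Φ.transport d : ℂˣ) : ℂ)‖ = 1 := fun s => by
    rw [Units.coe_prod, norm_prod, Finset.prod_eq_one fun d _ => hΦ d]
  have hM : ‖(Φ.monodromy (G.faceOf d₀) : ℂ)‖ = 1 := by
    rw [Φ.monodromy_faceOf]; exact hprod _
  have h0 := Units.ne_zero (Φ.monodromy (G.faceOf d₀))
  have h1 : ‖(Φ.monodromy (G.faceOf d₀) : ℂ) - 1‖ =
      ‖1 - (((Φ.monodromy (G.faceOf d₀))⁻¹ : ℂˣ) : ℂ)‖ := by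
    rw [Units.val_inv_eq_inv_val, ← one_mul ‖1 - _‖, ← hM, ← norm_mul, mul_sub, mul_one,
      mul_inv_cancel₀ h0]
  rw [h1, ← norm_mul, ← Φ.covDeriv_faceWalk f d₀]
  calc _ ≤ ∑ k ∈ Finset.range (Function.minimalPeriod (G.rot * G.rev) d₀),
        ‖Φ.covDeriv f ((G.rot * G.rev)^[k] d₀)‖ := by
        refine (norm_sum_le _ _).trans (Finset.sum_le_sum fun k _ => ?_)
        rw [norm_mul, Units.val_inv_eq_inv_val, norm_inv, Units.coe_prod, norm_prod,
          Finset.prod_eq_one fun j _ => hΦ _]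
        simp
    _ = ∑ d with cyc (G.rot * G.rev) d d₀, ‖Φ.covDeriv f d‖ :=
        (sum_cycle_eq_sum_range (G.rot * G.rev) d₀ fun d => ‖Φ.covDeriv f d‖).symm
    _ ≤ _ := Finset.sum_le_sum_of_subset_of_nonneg (Finset.filter_subset _ _)
        fun _ _ _ => norm_nonneg _

theorem EmbeddedGraph.Conductance.sq_sum_le {G : EmbeddedGraph V D} (c : G.Conductance)
    (u : D → ℝ) :
    (∑ d, u d) ^ 2 ≤ (∑ d, (c.weight d)⁻¹) * ∑ d, c.weight d * u d ^ 2 := by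
  have h := Finset.sum_mul_sq_le_sq_mul_sq Finset.univ (fun d => √(c.weight d)⁻¹)
    fun d => √(c.weight d) * u d
  have h1 : ∀ d, √(c.weight d)⁻¹ * (√(c.weight d) * u d) = u d := fun d => by
    rw [← mul_assoc, ← Real.sqrt_mul (inv_nonneg.2 (c.weight_pos d).le),
      inv_mul_cancel₀ (c.weight_pos d).ne', Real.sqrt_one, one_mul]
  simpa only [h1, mul_pow, Real.sq_sqrt (inv_nonneg.2 (c.weight_pos _).le),
    Real.sq_sqrt (c.weight_pos _).le] using h

variable [Fintype V]

theorem laurentLaplacian_mulVec {G : EmbeddedGraph V D} (c : G.Conductance) {n : D → ℤ}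
    (hn : ∀ d, n (G.rev d) = -n d) (z : ℂˣ) (f : V → ℂ) :
    ((laurentLaplacian c n).map (LaurentPolynomial.eval₂ (RingHom.id ℂ) z)).mulVec f =
      EmbeddedGraph.laplacian c (G.powConnection n hn z) f := by
  rw [← toMatrix'_laplacian c hn, LinearMap.toMatrix'_mulVec]

theorem laurentEval_adjugate (A : Matrix V V ℂ[T;T⁻¹]) (z : ℂˣ) (v w : V) :
    laurentEval z (A.adjugate v w) =
      (A.map (LaurentPolynomial.eval₂ (RingHom.id ℂ) z)).adjugate v w := by
  have := RingHom.map_adjugate (LaurentPolynomial.eval₂ (RingHom.id ℂ) z) A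
  exact congrFun (congrFun this v) w

/-- On the unit circle the determinant of the Laplacian is bounded below by the principal
minor. -/
theorem AnnularGraph.norm_minor_le (G : AnnularGraph V D) (c : G.toEmbeddedGraph.Conductance)
    {n : D → ℤ} (hn : ∀ d, n (G.rev d) = -n d)
    (hflat : ∀ z, G.IsFlatWithMonodromy (G.powConnection n hn z) z) {d₀ : D}
    (hd₀ : G.faceOf d₀ = G.inner) {z : ℂˣ} (hz : ‖(z : ℂ)‖ = 1) :
    ‖(z : ℂ) - 1‖ ^ 2 * ‖laurentEval z ((laurentLaplacian c n).adjugate (G.tail d₀) (G.tail d₀))‖ ≤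
      (∑ d, (c.weight d)⁻¹) * (2 * ‖laurentEval z (laurentLaplacian c n).det‖) := by
  set Φ := G.powConnection n hn z with hΦdef
  have hΦ := G.norm_transport_powConnection hn hz
  set A := (laurentLaplacian c n).map (LaurentPolynomial.eval₂ (RingHom.id ℂ) z) with hA
  -- A column of the adjugate solves `Δ f = det · δ`, also when the determinant vanishes. Its energy
  -- is twice the product of the minor and the determinant, in absolute value.
  let f : V → ℂ := fun v => A.adjugate v (G.tail d₀)
  have hf : EmbeddedGraph.laplacian c Φ f = Pi.single (G.tail d₀) A.det := by
    rw [← laurentLaplacian_mulVec c hn]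
    ext v
    have := congrFun (congrFun (Matrix.mul_adjugate A) v) (G.tail d₀)
    rw [Matrix.mul_apply] at this
    rw [Matrix.mulVec, dotProduct]
    refine this.trans ?_
    simp [Matrix.one_apply, Pi.single_apply]
  have hdet : laurentEval z (laurentLaplacian c n).det = A.det := by
    rw [laurentEval_eq, RingHom.map_det]; rfl
  have hM : laurentEval z ((laurentLaplacian c n).adjugate (G.tail d₀) (G.tail d₀)) =
      f (G.tail d₀) := laurentEval_adjugate _ _ _ _
  rw [hdet, hM]
  have hE := EmbeddedGraph.Connection.dirichlet_energy c hΦ f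
  rw [hf, Finset.sum_eq_single (G.tail d₀) (fun v _ hv => by simp [hv]) (by simp),
    Pi.single_eq_same] at hE
  have hE' : 2 * (‖f (G.tail d₀)‖ * ‖A.det‖) = ∑ d, c.weight d * ‖Φ.covDeriv f d‖ ^ 2 := by
    have h := congrArg norm hE
    rw [norm_mul, norm_mul, RCLike.norm_conj, Complex.norm_real, Real.norm_of_nonneg
      (Finset.sum_nonneg fun d _ => mul_nonneg (c.weight_pos d).le (sq_nonneg _))] at h
    simpa using h
  have h1 := EmbeddedGraph.Connection.norm_mul_le_sum_covDeriv hΦ f d₀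
  rw [hd₀, (hflat z).2] at h1
  have h2 := pow_le_pow_left₀ (by positivity) h1 2
  have h3 := h2.trans (c.sq_sum_le fun d => ‖Φ.covDeriv f d‖)
  rw [← hE'] at h3
  rcases (norm_nonneg (f (G.tail d₀))).eq_or_lt with h0 | h0
  · rw [← h0, mul_zero]
    exact mul_nonneg (Finset.sum_nonneg fun d _ => inv_nonneg.2 (c.weight_pos d).le)
      (by positivity)
  · refine le_of_mul_le_mul_right ?_ h0
    calc _ = (‖(z : ℂ) - 1‖ * ‖f (G.tail d₀)‖) ^ 2 := by ring
      _ ≤ _ := h3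
      _ = _ := by ring

/-- A kernel vector of the matrix with row `v₀` replaced vanishes at `v₀` and is harmonic elsewhere.
It has zero energy, and is zero by connectedness. -/
theorem EmbeddedGraph.Connected.laurentEval_one_minor_ne_zero {G : EmbeddedGraph V D}
    (hG : G.Connected) (c : G.Conductance) {n : D → ℤ} (hn : ∀ d, n (G.rev d) = -n d) (v₀ : V) :
    laurentEval 1 ((laurentLaplacian c n).adjugate v₀ v₀) ≠ 0 := by
  rw [laurentEval_adjugate, Matrix.adjugate_apply]
  intro h
  obtain ⟨g, hg0, hg⟩ := Matrix.exists_mulVec_eq_zero_iff.2 h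
  have h1 : g v₀ = 0 := by
    have := congrFun hg v₀
    rw [Matrix.mulVec, Matrix.updateRow_self] at this
    simpa using this
  have h2 : ∀ v, v ≠ v₀ → EmbeddedGraph.laplacian c (G.powConnection n hn 1) g v = 0 := by
    intro v hv
    have := congrFun hg v
    rw [Matrix.mulVec, Matrix.updateRow_ne hv] at this
    rw [← laurentLaplacian_mulVec c hn]
    exact this
  have hE := EmbeddedGraph.Connection.dirichlet_energy c
    (G.norm_transport_powConnection hn (z := 1) (by simp)) g
  rw [Finset.sum_eq_zero, mul_zero] at hE
  · have hE' : ∑ d, c.weight d * ‖(G.powConnection n hn 1).covDeriv g d‖ ^ 2 = 0 := by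
      exact_mod_cast hE.symm
    rw [Finset.sum_eq_zero_iff_of_nonneg
      fun d _ => mul_nonneg (c.weight_pos d).le (sq_nonneg _)] at hE'
    refine hg0 (hG.eq_zero_of_covDeriv_eq_zero (Φ := G.powConnection n hn 1) (fun d => ?_) h1)
    have := hE' d (Finset.mem_univ d)
    rw [mul_eq_zero, or_iff_right (c.weight_pos d).ne'] at this
    simpa using this
  · intro v _
    by_cases hv : v = v₀
    · rw [hv, h1, map_zero, zero_mul]
    · rw [h2 v hv, mul_zero]

/-- The point `exp (iθ)` of the unit circle. -/
noncomputable def expUnit (θ : ℝ) : ℂˣ :=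
  Units.mk0 (Complex.exp (θ * Complex.I)) (Complex.exp_ne_zero _)

theorem continuous_laurentEval_expUnit (P : ℂ[T;T⁻¹]) :
    Continuous fun θ => laurentEval (expUnit θ) P := by
  induction P using LaurentPolynomial.induction_on' with
  | add p q hp hq =>
    simp only [laurentEval_eq, map_add] at hp hq ⊢
    exact hp.add hq
  | C_mul_T n a =>
    simp only [laurentEval_eq, LaurentPolynomial.eval₂_C_mul_T, Units.val_zpow_eq_zpow_val]
    refine continuous_const.mul (Continuous.zpow₀ ?_ n fun θ => Or.inl (Units.ne_zero _))
    simp only [expUnit, Units.val_mk0]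
    fun_prop

theorem expUnit_zero : expUnit 0 = 1 := by
  ext; simp [expUnit]

/-- Divide the bound on the minor by `|z - 1|²` and let `z` tend to `1` along the unit circle: `R(1)
= 0` would make the minor vanish at `1`. -/
theorem AnnularGraph.laurentEval_one_ne_zero (G : AnnularGraph V D)
    (c : G.toEmbeddedGraph.Conductance) {n : D → ℤ} (hn : ∀ d, n (G.rev d) = -n d)
    (hflat : ∀ z, G.IsFlatWithMonodromy (G.powConnection n hn z) z) {R : ℂ[T;T⁻¹]}
    (hR : (laurentLaplacian c n).det = (LaurentPolynomial.T 1 - 1) ^ 2 * R) :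
    laurentEval 1 R ≠ 0 := by
  obtain ⟨d₀, hd₀⟩ := G.exists_faceOf_eq G.inner
  set M := (laurentLaplacian c n).adjugate (G.tail d₀) (G.tail d₀)
  have hle : ∀ᶠ θ in nhdsWithin (0 : ℝ) (Set.Ioi 0), ‖laurentEval (expUnit θ) M‖ ≤
      (∑ d, (c.weight d)⁻¹) * (2 * ‖laurentEval (expUnit θ) R‖) := by
    filter_upwards [Ioo_mem_nhdsGT Real.pi_pos] with θ hθ
    have hz : ‖((expUnit θ : ℂˣ) : ℂ)‖ = 1 := by
      rw [expUnit, Units.val_mk0, Complex.norm_exp_ofReal_mul_I]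
    have h1 : (expUnit θ : ℂ) - 1 ≠ 0 := by
      intro h
      have h2 := congrArg Complex.im h
      rw [expUnit, Units.val_mk0, Complex.sub_im, Complex.exp_ofReal_mul_I_im, Complex.one_im,
        sub_zero, Complex.zero_im] at h2
      exact (Real.sin_pos_of_mem_Ioo hθ).ne' h2
    have h2 := G.norm_minor_le c hn hflat hd₀ hz
    rw [hR] at h2
    have h3 : laurentEval (expUnit θ) ((LaurentPolynomial.T 1 - 1) ^ 2 * R) =
        ((expUnit θ : ℂ) - 1) ^ 2 * laurentEval (expUnit θ) R := by
      rw [laurentEval_eq, laurentEval_eq, map_mul, map_pow, map_sub, map_one,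
        LaurentPolynomial.eval₂_T, zpow_one]
    rw [h3, norm_mul, norm_pow] at h2
    refine le_of_mul_le_mul_left (h2.trans_eq ?_) (pow_pos (norm_pos_iff.2 h1) 2)
    ring
  have hM : Filter.Tendsto (fun θ => ‖laurentEval (expUnit θ) M‖) (nhdsWithin (0 : ℝ) (Set.Ioi 0))
      (nhds ‖laurentEval (expUnit 0) M‖) :=
    ((continuous_laurentEval_expUnit M).norm.tendsto 0).mono_left nhdsWithin_le_nhds
  have hRt : Filter.Tendsto (fun θ => (∑ d, (c.weight d)⁻¹) * (2 * ‖laurentEval (expUnit θ) R‖))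
      (nhdsWithin (0 : ℝ) (Set.Ioi 0))
      (nhds ((∑ d, (c.weight d)⁻¹) * (2 * ‖laurentEval (expUnit 0) R‖))) :=
    ((continuous_const.mul (continuous_const.mul
      (continuous_laurentEval_expUnit R).norm)).tendsto 0).mono_left nhdsWithin_le_nhds
  have h := le_of_tendsto_of_tendsto hM hRt hle
  rw [expUnit_zero] at h
  intro h0
  rw [h0, norm_zero, mul_zero, mul_zero] at h
  exact G.connected.laurentEval_one_minor_ne_zero c hn (G.tail d₀) (norm_le_zero_iff.1 h)

end DoubleRoot

/-! ### Cutting away the zeros of the form; absence of roots off the positive axis. -/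

section Roots

open Classical

variable {V D : Type*} [Fintype D]

/-- A set of darts can be taken out of a planar map. -/
theorem exists_detached {σ α : Equiv.Perm D} (hα : ∀ d, α (α d) = d) (hne : ∀ d, α d ≠ d)
    (hdef : eulerDefect σ α = 0) {n : D → ℝ} (hn : ∀ d, n (α d) = -n d)
    (hosc : OscillationBound σ α n) (S : Finset D) :
    ∃ τ : Equiv.Perm D, (∀ d ∈ S, τ d = d) ∧ cyc τ ≤ cyc σ ∧
      (∀ d e, d ∉ S → e ∉ S → cyc σ d e → cyc τ d e) ∧ eulerDefect τ α = 0 ∧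
      OscillationBound τ α n := by
  induction S using Finset.induction_on with
  | empty => exact ⟨σ, by simp, le_rfl, fun _ _ _ _ h => h, hdef, hosc⟩
  | insert a S ha ih =>
    obtain ⟨τ, h1, h2, h3, h4, h5⟩ := ih
    have hdef' : eulerDefect (detach τ a) α = 0 :=
      le_antisymm ((eulerDefect_detach τ α a).1.trans h4.le) (eulerDefect_nonneg hα hne _)
    refine ⟨detach τ a, fun d hd => ?_, ?_, fun d e hd he hde => ?_, hdef',
      h5.detach hn (by rw [h4, hdef'])⟩
    · rcases Finset.mem_insert.1 hd with rfl | hd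
      · exact detach_self _ _
      · exact detach_of_fixed (h1 d hd)
    · refine le_trans (cyc_le_iff.2 fun d => ?_) h2
      refine rel_of_forall_classFun fun x hx => ?_
      rw [mem_classFun_cyc] at hx
      rw [apply_detach (hx a).symm, hx]
    · rw [Finset.mem_insert, not_or] at hd he
      refine rel_of_forall_classFun fun x hx => ?_
      rw [mem_classFun_cyc] at hx
      -- Giving `a` the value of its successor turns a class function of the detached rotation into
      -- one of `τ`, with the other values untouched.
      have hy : Function.update x a (x (τ a)) ∈ classFun (cyc τ) := by
        rw [mem_classFun_cyc]
        have hya : Function.update x a (x (τ a)) a = Function.update x a (x (τ a)) (τ a) := by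
          by_cases h : τ a = a
          · rw [h]
          · rw [Function.update_self, Function.update_of_ne h]
        intro d
        rw [← apply_detach hya]
        by_cases hda : d = a
        · rw [hda, detach_self]
        · have : detach τ a d ≠ a := fun h =>
            hda ((detach τ a).injective (h.trans (detach_self τ a).symm))
          rw [Function.update_of_ne this, Function.update_of_ne hda, hx]
      have := mem_classFun.1 hy _ _ (h3 d e hd.2 he.2 hde)
      rwa [Function.update_of_ne hd.1, Function.update_of_ne he.1] at this

/-- The darts where the derivative vanishes are detached, and the rigidity statement is applied to
the remaining map. -/
theorem AnnularGraph.covDeriv_eq_zero_of_arg_ne_zero (G : AnnularGraph V D)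
    (c : G.toEmbeddedGraph.Conductance) {n : D → ℤ} (hn : ∀ d, n (G.rev d) = -n d)
    (hosc : OscillationBound G.rot G.rev fun d => (n d : ℝ)) {z : ℂˣ} (hz : Complex.arg z ≠ 0)
    {f : V → ℂ} (hf : EmbeddedGraph.laplacian c (G.powConnection n hn z) f = 0) (d : D) :
    (G.powConnection n hn z).covDeriv f d = 0 := by
  set Φ := G.powConnection n hn z
  set ω := Φ.covDeriv f with hω
  obtain ⟨τ, h1, h2, h3, h4, h5⟩ := exists_detached G.rev_rev G.rev_ne G.eulerDefect_eq_zero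
    (n := fun d => (n d : ℝ)) (fun d => by simp [hn]) hosc (Finset.univ.filter fun d => ω d = 0)
  simp only [Finset.mem_filter, Finset.mem_univ, true_and] at h1 h3
  have htail : ∀ d, G.tail (τ d) = G.tail d := fun d =>
    (G.tail_eq_iff _ _).2 (h2 (cyc_apply τ d))
  refine form_eq_zero_of_arg_ne_zero G.rev_rev G.rev_ne h4.le hn h5 hz (Φ.covDeriv_rev f) h1
    (fun d₀ hd₀ => ?_) (fun d₀ hd₀ hsum => ?_) d
  · have hclass : ∀ d, cyc τ d d₀ ↔ ω d ≠ 0 ∧ G.tail d = G.tail d₀ := by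
      refine fun d => ⟨fun h => ⟨fun h0 => ?_, (G.tail_eq_iff _ _).2 (h2 h)⟩,
        fun h => h3 d d₀ h.1 hd₀ ((G.tail_eq_iff _ _).1 h.2)⟩
      have hx : (fun e => if e = d then (1 : ℝ) else 0) ∈ classFun (cyc τ) :=
        mem_classFun_cyc.2 fun e => by
          have : τ e = d ↔ e = d :=
            ⟨fun h => τ.injective (h.trans (h1 d h0).symm), fun h => by rw [h, h1 d h0]⟩
          simp only [this]
      have h6 := mem_classFun.1 hx _ _ h
      by_cases h7 : d₀ = d
      · exact hd₀ (by rw [h7]; exact h0)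
      · simp [h7] at h6
    -- At a vertex the closing relation is harmonicity of `f`; the detached darts contribute zero to
    -- it.
    have h6 := two_pi_le_turning τ d₀ (fun _ => 1) ω c.weight (fun d hd => ((hclass d).1 hd).1)
      c.weight_pos (by simp) (by
        simp only [Finset.prod_const_one, inv_one, Units.val_one, one_mul]
        rw [← sum_cycle_eq_sum_range τ d₀ fun d => (c.weight d : ℂ) * ω d]
        have h7 := congrFun hf (G.tail d₀)
        rw [Φ.laplacian_apply, Pi.zero_apply] at h7
        rw [← h7]
        refine Finset.sum_subset_zero_on_sdiff (fun d hd => ?_) (fun d hd => ?_) fun _ _ => rfl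
        · simp only [Finset.mem_filter, Finset.mem_univ, true_and] at hd ⊢
          exact ((hclass d).1 hd).2
        · simp only [Finset.mem_sdiff, Finset.mem_filter, Finset.mem_univ, true_and, hclass,
            not_and_or, not_not] at hd
          rcases hd.2 with h | h
          · rw [← hω, h, mul_zero]
          · exact absurd hd.1 h)
    simpa using h6
  -- Since `τ` preserves tails, the derivatives still telescope along the faces of the thinned map,
  -- and zero total exponent closes the sum up.
  · refine two_pi_le_turning (τ * G.rev) d₀ Φ.transport ω (fun _ => 1) hd₀ (fun _ => one_pos) ?_ ?_
    · refine (prod_zpow_eq_zpow_sum _ z n).trans ?_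
      rw [hsum, zpow_zero]
    · simp only [Complex.ofReal_one, one_mul]
      rw [sum_covDeriv_path (x := fun d => f (G.tail d)), Function.iterate_minimalPeriod,
        ← prod_cycle_eq_prod_range (τ * G.rev) d₀ Φ.transport]
      · have h6 : ∏ d with cyc (τ * G.rev) d d₀, Φ.transport d = 1 := by
          refine (prod_zpow_eq_zpow_sum _ z n).trans ?_
          rw [hsum, zpow_zero]
        rw [h6]
        simp
      · intro d
        rw [hω, EmbeddedGraph.Connection.covDeriv, Φ.transport_rev, Equiv.Perm.mul_apply, htail]
        rfl

/-- A Laplacian whose monodromy is not a positive real number is injective. -/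
theorem AnnularGraph.arg_eq_zero_of_laplacian_eq_zero (G : AnnularGraph V D)
    (c : G.toEmbeddedGraph.Conductance) {n : D → ℤ} (hn : ∀ d, n (G.rev d) = -n d)
    (hosc : OscillationBound G.rot G.rev fun d => (n d : ℝ)) {z : ℂˣ}
    (hflat : G.IsFlatWithMonodromy (G.powConnection n hn z) z) {f : V → ℂ} (hf0 : f ≠ 0)
    (hf : EmbeddedGraph.laplacian c (G.powConnection n hn z) f = 0) : Complex.arg z = 0 := by
  by_contra hz
  have h := G.covDeriv_eq_zero_of_arg_ne_zero c hn hosc hz hf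
  obtain ⟨d₀, hd₀⟩ := G.exists_faceOf_eq G.inner
  have h1 := (G.powConnection n hn z).covDeriv_faceWalk f d₀
  rw [hd₀, hflat.2] at h1
  simp only [h, mul_zero, Finset.sum_const_zero] at h1
  rcases mul_eq_zero.1 h1.symm with h2 | h2
  · have : z = 1 := by
      rw [← inv_eq_one]
      ext
      rw [Units.val_one]
      exact (sub_eq_zero.1 h2).symm
    rw [this] at hz
    simp at hz
  · exact hf0 (G.connected.eq_zero_of_covDeriv_eq_zero h h2)

end Roots

/-! ### Assembly of the theorem. -/

theorem mainTheorem4 {V D : Type*} [Fintype V] [Fintype D] (G : AnnularGraph V D)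
    (c : G.toEmbeddedGraph.Conductance) :
    (∀ z : ℂˣ, ∃ Φ : G.toEmbeddedGraph.Connection, G.IsFlatWithMonodromy Φ z) ∧
    ∃ P : ℂ[T;T⁻¹],
      (∀ (z : ℂˣ) (Φ : G.toEmbeddedGraph.Connection), G.IsFlatWithMonodromy Φ z →
        LinearMap.det (EmbeddedGraph.laplacian c Φ) = laurentEval z P) ∧
      LaurentPolynomial.invert P = P ∧
      (∀ z : ℂˣ, laurentEval z P = 0 → ∃ r : ℝ, 0 < r ∧ (z : ℂ) = (r : ℂ)) ∧
      (∃ R : ℂ[T;T⁻¹], P = (LaurentPolynomial.T 1 - 1) ^ 2 * R ∧ laurentEval 1 R ≠ 0) := by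
  classical
  obtain ⟨a, ha⟩ := G.exists_faceOf_eq G.inner
  obtain ⟨b, hb⟩ := G.exists_faceOf_eq G.outer
  obtain ⟨n, hn, hsum⟩ := exists_cochain G.rev_rev G.orbits_eq_top a b
  have hflat := fun z => G.isFlat_powConnection hn ha hb (by convert hsum) z
  have hosc : OscillationBound G.rot G.rev fun d => (n d : ℝ) :=
    OscillationBound.of_top G.orbits_eq_top (a := a) (b := b) fun d₀ => by
      have := congrArg (Int.cast : ℤ → ℝ) (hsum d₀)
      push_cast at this
      convert this
  have hinv := invert_det_laurentLaplacian c hn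
  have hroot : ∀ z : ℂˣ, ∀ f : V → ℂ, f ≠ 0 →
      EmbeddedGraph.laplacian c (G.powConnection n hn z) f = 0 →
      laurentEval z (laurentLaplacian c n).det = 0 := by
    intro z f hf0 hf
    rw [← det_laplacian_eq_laurentEval c hn]
    by_contra h
    exact hf0 ((LinearMap.equivOfDetNeZero _ h).injective (by
      rw [map_zero]
      exact hf))
  have hone : laurentEval 1 (laurentLaplacian c n).det = 0 := by
    refine hroot 1 (fun _ => 1) (fun h => one_ne_zero (congrFun h (G.tail a))) ?_
    ext v
    rw [EmbeddedGraph.Connection.laplacian_apply]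
    simp [EmbeddedGraph.Connection.covDeriv, EmbeddedGraph.powConnection]
  obtain ⟨R, hR⟩ := sub_one_sq_dvd_of_reciprocal hinv hone
  refine ⟨fun z => ⟨_, hflat z⟩, (laurentLaplacian c n).det, fun z Φ hΦ => ?_, hinv,
    fun z hz => ?_, R, hR, G.laurentEval_one_ne_zero c hn hflat hR⟩
  · rw [G.det_laplacian_eq c hΦ (hflat z), det_laplacian_eq_laurentEval]
  · rw [← det_laplacian_eq_laurentEval c hn] at hz
    obtain ⟨f, hf, hf0⟩ := Submodule.exists_mem_ne_zero_of_ne_bot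
      (LinearMap.bot_lt_ker_of_det_eq_zero hz).ne'
    have harg := G.arg_eq_zero_of_laplacian_eq_zero c hn hosc (hflat z) hf0 (LinearMap.mem_ker.1 hf)
    refine ⟨‖(z : ℂ)‖, norm_pos_iff.2 z.ne_zero, ?_⟩
    have := Complex.norm_mul_exp_arg_mul_I (z : ℂ)
    rw [harg] at this
    simpa using this.symm
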